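/- Let $n\ge 0$ and $m\ge 1$ be integers, let $D\subset\mathbb{C}^n$ be a bounded domain (non-empty, open, connected), and let $\varphi:D\to(0,\infty)$ be bounded and continuous. Put $$\Omega=\{(z,\zeta)\in D\times\mathbb{C}: |\zeta|^2<\varphi(z)\},\qquad \widetilde\Omega=\{(z,Z)\in D\times\mathbb{C}^m: \|Z\|^2<\varphi(z)\},$$ where $\|\cdot\|$ is the Euclidean norm. The Bergman kernel of a domain $U$ is the reproducing kernel $K$ of the space of square-integrable holomorphic functions on $U$ (with Lebesgue measure $V$): for each $p\in U$ the function $q\mapsto\overline{K(p,q)}$ is holomorphic and square-integrable on $U$, and $f(p)=\int_U f(q)K(p,q)\,dV_q$ for every square-integrable holomorphic function $f$ on $U$. Then $\Omega$ and $\widetilde\Omega$ have Bergman kernels $K$ and $\widetilde K$. There is a function $L(z,w,t)$, defined for $z,w\in D$ and $|t|<\sqrt{\varphi(z)\varphi(w)}$ and holomorphic in $t$, such that $$K\big((z,\zeta),(w,\eta)\big)=L(z,w,\zeta\bar\eta)\qquad\text{for all }(z,\zeta),(w,\eta)\in\Omega .$$ For every function $L$ with this last property, and for all $(z,Z),(w,W)\in\widetilde\Omega$,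 $$\widetilde K\big((z,Z),(w,W)\big)=\frac{1}{\pi^{m-1}}\left.\frac{\partial^{m-1}}{\partial t^{m-1}}L(z,w,t)\right|_{t=\langle Z,W\rangle},\qquad \langle Z,W\rangle=\sum_{j=1}^m Z_j\overline{W_j}.$$ -/

import Mathlib

open MeasureTheory

/-- The Bergman space of `U`: the holomorphic functions on `U` that are square-integrable with
respect to Lebesgue measure. (Functions are total; only their values on `U` matter.) -/
def IsBergmanFunction {E : Type*} [NormedAddCommGroup E] [NormedSpace ℂ E] [MeasureSpace E]
    (U : Set E) (f : E → ℂ) : Prop :=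
  DifferentiableOn ℂ f U ∧ MemLp f 2 (volume.restrict U)

/-- `K` is the reproducing kernel of the Bergman space of `U`: for each `z ∈ U` the function
`w ↦ conj (K z w)` is in the Bergman space, and `f z = ∫_U f(w) K(z, w) dV_w` for each `f` in the
Bergman space and each `z ∈ U`. -/
def IsBergmanKernel {E : Type*} [NormedAddCommGroup E] [NormedSpace ℂ E] [MeasureSpace E]
    (U : Set E) (K : E → E → ℂ) : Prop :=
  (∀ z ∈ U, IsBergmanFunction U (fun w => starRingEnd ℂ (K z w))) ∧
  ∀ f : E → ℂ, IsBergmanFunction U f → ∀ z ∈ U, f z = ∫ w in U, f w * K z w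

open Classical in
/-- The Bergman kernel function of `U` (a junk value if the Bergman space of `U` has no
reproducing kernel). Its values at points outside `U` have no meaning. -/
noncomputable def bergmanKernel {E : Type*} [NormedAddCommGroup E] [NormedSpace ℂ E]
    [MeasureSpace E] (U : Set E) : E → E → ℂ :=
  if h : ∃ K : E → E → ℂ, IsBergmanKernel U K then h.choose else 0

/-- The Hartogs domain `{(z, ζ) : z ∈ D, |ζ|² < φ(z)}` in `ℂⁿ × ℂ`. -/
def hartogsDomain {n : ℕ} (D : Set (EuclideanSpace ℂ (Fin n)))
    (φ : EuclideanSpace ℂ (Fin n) → ℝ) : Set (EuclideanSpace ℂ (Fin n) × ℂ) :=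
  {p | p.1 ∈ D ∧ ‖p.2‖ ^ 2 < φ p.1}

/-- The inflated domain `{(z, Z) : z ∈ D, ‖Z‖² < φ(z)}` in `ℂⁿ × ℂᵐ`, with the Euclidean norm. -/
def inflatedDomain {n : ℕ} (m : ℕ) (D : Set (EuclideanSpace ℂ (Fin n)))
    (φ : EuclideanSpace ℂ (Fin n) → ℝ) :
    Set (EuclideanSpace ℂ (Fin n) × EuclideanSpace ℂ (Fin m)) :=
  {p | p.1 ∈ D ∧ ‖p.2‖ ^ 2 < φ p.1}

/-- `K((z, ζ), (w, η)) = L(z, w, ζ * conj η)` on the Hartogs domain, `K` its Bergman kernel. -/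
def RepresentsHartogsKernel {n : ℕ} (D : Set (EuclideanSpace ℂ (Fin n)))
    (φ : EuclideanSpace ℂ (Fin n) → ℝ)
    (L : EuclideanSpace ℂ (Fin n) → EuclideanSpace ℂ (Fin n) → ℂ → ℂ) : Prop :=
  ∀ p ∈ hartogsDomain D φ, ∀ q ∈ hartogsDomain D φ,
    bergmanKernel (hartogsDomain D φ) p q = L p.1 q.1 (p.2 * starRingEnd ℂ q.2)

set_option linter.unusedSectionVars false

/-! ### Averaging over the unit circle -/

/-! Both kernels are expanded in powers of the fibre inner product, and the same weighted kernels on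
`D` appear in both expansions. Let `B j` be the reproducing kernel of the holomorphic functions on
`D` that are square-integrable for `φ ^ j dV`. For a fibre `V` of complex dimension `d`, let `γ k`
be the integral of `|⟨u, W⟩| ^ (2k)` over the unit ball, `u` a unit vector. Then the kernel of
`{‖Z‖² < φ(z)}` is `K((z, Z), (w, W)) = ∑ₖ (γ k)⁻¹ B (k + d) (z, w) ⟨Z, W⟩ ^ k`
(`hasSum_bergmanKernel_fibredBall`).

The reason is a fibrewise projection (`setIntegral_ball_mul_inner_pow`): pairing a holomorphic `g`
on a ball with the `k`-th power of the linear form along `u` sees only the `k`-th Taylor coefficient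
of `c ↦ g (c • u)`, multiplied by the moment `γ k * r ^ (2 * (k + d))`. On the fibre over `z` one
has `r² = φ(z)`, so the remaining integral over `D` carries the weight `φ ^ (k + d)`, and `B (k +
d)` reproduces the coefficient as a function of `z`.

The moments are `γ k = π k! / (k + 1)!` for `V = ℂ` and `π ^ m k! / (k + m)!` for `V = ℂᵐ`.
Differentiating the series for `ℂ` termwise `m - 1` times shifts `B (k + 1)` to `B (k + m)`, and the
factorials combine to `π ^ (m - 1)` times the coefficients for `ℂᵐ`. -/

lemma measurePreserving_prod_circleMap {X : Type*} [MeasurableSpace X] {μ : Measure X}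
    [SFinite μ] {ρ : ℂ → X → X} (hρ : Measurable (Function.uncurry ρ))
    (hμ : ∀ c : ℂ, ‖c‖ = 1 → MeasurePreserving (ρ c) μ μ) :
    MeasurePreserving (fun p : ℝ × X => (p.1, ρ (circleMap 0 1 p.1) p.2))
      ((volume.restrict (Set.Ioc 0 (2 * Real.pi))).prod μ)
      ((volume.restrict (Set.Ioc 0 (2 * Real.pi))).prod μ) := by
  refine (MeasurePreserving.id _).skew_product (g := fun θ x => ρ (circleMap 0 1 θ) x) ?_ ?_
  · have : Measurable fun p : ℝ × X => ((circleMap 0 1 p.1, p.2) : ℂ × X) :=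
      ((continuous_circleMap 0 1).measurable.comp measurable_fst).prodMk measurable_snd
    exact hρ.comp this
  · exact Filter.Eventually.of_forall fun θ => (hμ _ (by simp)).map_eq

/-- Each `ρ c` leaves the integral of `F` unchanged, so averaging over `c` and exchanging the
integrals changes nothing. Integrability of the average is recorded so that a second average can
follow the first. -/
lemma integrable_circleAverage_and_integral_eq {X : Type*} [MeasurableSpace X] {μ : Measure X}
    [SFinite μ] {ρ : ℂ → X → X} (hρ : Measurable (Function.uncurry ρ))
    (hμ : ∀ c : ℂ, ‖c‖ = 1 → MeasurePreserving (ρ c) μ μ) {F : X → ℂ} (hF : Integrable F μ) :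
    Integrable (fun x => Real.circleAverage (fun c => F (ρ c x)) 0 1) μ ∧
      ∫ x, F x ∂μ = ∫ x, Real.circleAverage (fun c => F (ρ c x)) 0 1 ∂μ := by
  have key := measurePreserving_prod_circleMap hρ hμ
  have hint : Integrable (fun p : ℝ × X => F (ρ (circleMap 0 1 p.1) p.2))
      ((volume.restrict (Set.Ioc 0 (2 * Real.pi))).prod μ) :=
    (key.integrable_comp_of_integrable (hF.comp_snd _))
  simp only [Real.circleAverage_def]
  refine ⟨Integrable.smul _ ?_, ?_⟩
  · simp only [intervalIntegral.integral_of_le Real.two_pi_pos.le]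
    exact hint.integral_prod_right
  rw [integral_smul]
  simp only [intervalIntegral.integral_of_le Real.two_pi_pos.le]
  rw [← integral_integral_swap hint]
  have h1 : ∀ θ : ℝ, ∫ x, F (ρ (circleMap 0 1 θ) x) ∂μ = ∫ x, F x ∂μ := by
    intro θ
    have h := hμ (circleMap 0 1 θ) (by simp)
    have := integral_map h.measurable.aemeasurable (f := F)
      (by rw [h.map_eq]; exact hF.aestronglyMeasurable)
    rw [h.map_eq] at this
    exact this.symm
  simp only [h1]
  rw [integral_const, smul_smul]
  have : (Real.pi : ℂ) ≠ 0 := by exact_mod_cast Real.pi_ne_zero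
  simp [Real.pi_pos.le]
  field_simp

/-! ### Linear isometries preserve Haar measure -/

/-- The image measure is again Haar, hence a multiple of `volume`. The unit ball is its own preimage
and has finite nonzero measure, which forces the factor to be one. -/
lemma LinearIsometryEquiv.measurePreserving_addHaar {E : Type*} [NormedAddCommGroup E]
    [NormedSpace ℂ E] [ProperSpace E] [MeasureSpace E] [BorelSpace E]
    [(volume : Measure E).IsAddHaarMeasure] (T : E ≃ₗᵢ[ℂ] E) :
    MeasurePreserving T (volume : Measure E) volume := by
  refine ⟨T.continuous.measurable, ?_⟩
  have : (Measure.map T (volume : Measure E)).IsAddHaarMeasure :=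
    T.toContinuousLinearEquiv.isAddHaarMeasure_map _
  have h := Measure.isAddLeftInvariant_eq_smul (Measure.map T (volume : Measure E)) volume
  have hb := congrArg (fun ν : Measure E => ν (Metric.ball 0 1)) h
  simp only [Measure.smul_apply] at hb
  rw [Measure.map_apply T.continuous.measurable Metric.isOpen_ball.measurableSet] at hb
  have hpre : T ⁻¹' Metric.ball 0 1 = Metric.ball 0 1 := by
    ext x; simp
  rw [hpre] at hb
  have h0 : (volume : Measure E) (Metric.ball 0 1) ≠ 0 := (Metric.measure_ball_pos _ _ one_pos).ne'
  have h1 : (volume : Measure E) (Metric.ball 0 1) ≠ ⊤ := measure_ball_lt_top.ne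
  rw [h]
  have hc : Measure.addHaarScalarFactor (Measure.map T (volume : Measure E)) volume = 1 := by
    have h2 := (ENNReal.eq_div_iff h0 h1).2 ((mul_comm _ _).trans hb.symm)
    rw [ENNReal.div_self h0 h1] at h2
    exact_mod_cast h2
  rw [hc, one_smul]

/-- Multiplication by a complex number of modulus one. -/
noncomputable def unitSMul {E : Type*} [NormedAddCommGroup E] [NormedSpace ℂ E] (c : ℂ)
    (hc : ‖c‖ = 1) : E ≃ₗᵢ[ℂ] E where
  toLinearEquiv := LinearEquiv.smulOfNeZero ℂ E c (by rintro rfl; simp at hc)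
  norm_map' x := by simp [norm_smul, hc]

@[simp] lemma unitSMul_apply {E : Type*} [NormedAddCommGroup E] [NormedSpace ℂ E] (c : ℂ)
    (hc : ‖c‖ = 1) (x : E) : unitSMul c hc x = c • x := rfl

lemma MeasureTheory.MeasurePreserving.restrict_of_preimage_eq {X : Type*} [MeasurableSpace X]
    {μ : Measure X} {T : X → X} (hT : MeasurePreserving T μ μ) {s : Set X} (hs : MeasurableSet s)
    (h : T ⁻¹' s = s) : MeasurePreserving T (μ.restrict s) (μ.restrict s) := by
  have := hT.restrict_preimage hs
  rwa [h] at this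

/-! ### The mean value inequality and local bounds -/

lemma enorm_integral_mul_sq_le {X : Type*} [MeasurableSpace X] {μ : Measure X} {f g : X → ℂ}
    (hf : AEStronglyMeasurable f μ) (hg : AEStronglyMeasurable g μ) :
    ‖∫ x, f x * g x ∂μ‖ₑ ^ 2 ≤ (∫⁻ x, ‖f x‖ₑ ^ 2 ∂μ) * ∫⁻ x, ‖g x‖ₑ ^ 2 ∂μ := by
  have h1 : ‖∫ x, f x * g x ∂μ‖ₑ ≤ ∫⁻ x, ‖f x‖ₑ * ‖g x‖ₑ ∂μ := by
    refine (enorm_integral_le_lintegral_enorm _).trans_eq ?_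
    simp [enorm_mul]
  have h2 := ENNReal.lintegral_mul_le_Lp_mul_Lq μ Real.HolderConjugate.two_two
    hf.enorm hg.enorm
  calc _ ≤ _ := pow_le_pow_left' (h1.trans h2) 2
    _ = _ := by
      rw [mul_pow, ← ENNReal.rpow_natCast, ← ENNReal.rpow_natCast, ← ENNReal.rpow_mul,
        ← ENNReal.rpow_mul]
      norm_num

section LocalBounds

variable {E : Type*} [NormedAddCommGroup E] [NormedSpace ℂ E] [ProperSpace E] [MeasureSpace E]
  [BorelSpace E] [(volume : Measure E).IsAddHaarMeasure]

/-- Averaging over the rotations `x ↦ c • x` replaces `f x` by the circle average of `c ↦ f (c •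
x)`, which is `f 0` by the one-variable mean value property. -/
lemma setIntegral_ball_eq_of_differentiableOn {f : E → ℂ} {r : ℝ}
    (hf : DifferentiableOn ℂ f (Metric.ball 0 r))
    (hi : IntegrableOn f (Metric.ball 0 r)) :
    ∫ x in Metric.ball 0 r, f x = (volume : Measure E).real (Metric.ball 0 r) • f 0 := by
  have hm : MeasurableSet (Metric.ball (0 : E) r) := Metric.isOpen_ball.measurableSet
  rw [(integrable_circleAverage_and_integral_eq (ρ := fun c x => c • x) (by fun_prop) ?_ hi).2]
  · rw [setIntegral_congr_fun (g := fun _ => f 0) hm, setIntegral_const]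
    intro x hx
    have hd : DifferentiableOn ℂ (fun c : ℂ => f (c • x)) (Metric.closedBall 0 |1|) := by
      refine hf.comp (by fun_prop) fun c hc => ?_
      simp only [abs_one, Metric.mem_closedBall, dist_zero_right, Metric.mem_ball] at hc hx ⊢
      rw [norm_smul]
      exact lt_of_le_of_lt (mul_le_of_le_one_left (norm_nonneg _) hc) hx
    have hdc : DiffContOnCl ℂ (fun c : ℂ => f (c • x)) (Metric.ball 0 |1|) :=
      hd.diffContOnCl_ball subset_rfl
    simpa using hdc.circleAverage
  · intro c hc
    refine MeasurePreserving.restrict_of_preimage_eq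
      (unitSMul (E := E) c hc).measurePreserving_addHaar hm ?_
    ext x; simp

/-- The mean value property combined with Cauchy–Schwarz against the constant `1`. If the right side
is finite, `f` is square-integrable on a ball of finite measure and hence integrable there. -/
lemma norm_sq_mul_volume_ball_le {f : E → ℂ} {p : E} {r : ℝ}
    (hf : DifferentiableOn ℂ f (Metric.ball p r)) :
    ‖f p‖ₑ ^ 2 * volume (Metric.ball p r) ≤ ∫⁻ x in Metric.ball p r, ‖f x‖ₑ ^ 2 := by
  have hshift : ∀ h : E → ENNReal,
      ∫⁻ x in Metric.ball p r, h x = ∫⁻ x in Metric.ball 0 r, h (p + x) := by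
    intro h
    rw [← (measurePreserving_add_left volume p).setLIntegral_comp_preimage_emb
      (measurableEmbedding_addLeft p)]
    simp
  set g : E → ℂ := fun x => f (p + x) with hg
  have hgd : DifferentiableOn ℂ g (Metric.ball 0 r) := by
    refine hf.comp (by fun_prop) fun x hx => ?_
    simpa using hx
  have hm : MeasurableSet (Metric.ball (0 : E) r) := Metric.isOpen_ball.measurableSet
  have hmeas : AEStronglyMeasurable g (volume.restrict (Metric.ball 0 r)) :=
    hgd.continuousOn.aestronglyMeasurable hm
  have hv : volume (Metric.ball p r) = volume (Metric.ball (0 : E) r) :=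
    Measure.addHaar_ball_center _ _ _
  rw [hshift, hv]
  by_cases htop : ∫⁻ x in Metric.ball 0 r, ‖g x‖ₑ ^ 2 = ⊤
  · rw [htop]; exact le_top
  have hfin : IsFiniteMeasure (volume.restrict (Metric.ball (0 : E) r)) :=
    ⟨by simpa using measure_ball_lt_top⟩
  have hL2 : MemLp g 2 (volume.restrict (Metric.ball 0 r)) := by
    refine ⟨hmeas, ?_⟩
    rw [eLpNorm_lt_top_iff_lintegral_rpow_enorm_lt_top (by norm_num) (by norm_num)]
    simpa using Ne.lt_top htop
  have hi : IntegrableOn g (Metric.ball 0 r) := hL2.integrable (by norm_num)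
  have h1 := setIntegral_ball_eq_of_differentiableOn hgd hi
  have h2 := enorm_integral_mul_sq_le hmeas (g := fun _ => 1) (by fun_prop)
  simp only [mul_one, h1, enorm_one, one_pow, lintegral_const, Measure.restrict_apply_univ, one_mul,
    enorm_smul, mul_pow] at h2
  have h3 : ‖(volume : Measure E).real (Metric.ball 0 r)‖ₑ = volume (Metric.ball (0 : E) r) := by
    rw [Measure.real, Real.enorm_eq_ofReal ENNReal.toReal_nonneg,
      ENNReal.ofReal_toReal measure_ball_lt_top.ne]
  rw [h3] at h2
  by_cases h0 : volume (Metric.ball (0 : E) r) = 0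
  · simp [h0]
  · rw [pow_two (volume _), mul_comm, ← mul_assoc] at h2
    have := (ENNReal.mul_le_mul_iff_left h0 measure_ball_lt_top.ne).1 h2
    simpa [hg] using this

end LocalBounds

/-! ### Locally uniform limits of holomorphic functions on open sets of a normed space -/

/-- The one-variable Cauchy estimate on each complex line through `x`. The radius is halved so that
the closed disc lies in the open ball. -/
lemma norm_fderiv_le_of_forall_mem_ball {E : Type*} [NormedAddCommGroup E] [NormedSpace ℂ E]
    {g : E → ℂ} {x : E} {r C : ℝ} (hr : 0 < r) (hg : DifferentiableOn ℂ g (Metric.ball x r))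
    (hC : ∀ y ∈ Metric.ball x r, ‖g y‖ ≤ C) : ‖fderiv ℂ g x‖ ≤ C / (r / 2) := by
  have hC0 : 0 ≤ C := (norm_nonneg _).trans (hC x (Metric.mem_ball_self hr))
  refine ContinuousLinearMap.opNorm_le_bound _ (by positivity) fun v => ?_
  rcases eq_or_ne v 0 with rfl | hv
  · simp
  have hv' : 0 < ‖v‖ := norm_pos_iff.2 hv
  have hmaps : Set.MapsTo (fun c : ℂ => x + c • v) (Metric.closedBall 0 (r / 2 / ‖v‖))
      (Metric.ball x r) := by
    intro c hc
    rw [mem_closedBall_zero_iff, le_div_iff₀ hv'] at hc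
    rw [Metric.mem_ball, dist_self_add_left, norm_smul]
    linarith
  have hd : DifferentiableOn ℂ (fun c : ℂ => g (x + c • v)) (Metric.closedBall 0 (r / 2 / ‖v‖)) :=
    hg.comp (by fun_prop) hmaps
  have h1 := Complex.norm_deriv_le_of_forall_mem_sphere_norm_le (by positivity)
    (hd.diffContOnCl_ball subset_rfl)
    (fun c hc => hC _ (hmaps (Metric.sphere_subset_closedBall hc)))
  have hgx : HasFDerivAt g (fderiv ℂ g x) (x + (0 : ℂ) • v) := by
    simpa using (hg.differentiableAt (Metric.ball_mem_nhds x hr)).hasFDerivAt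
  have h2 : HasDerivAt (fun c : ℂ => g (x + c • v)) (fderiv ℂ g x v) 0 := by
    have := ((hasDerivAt_id (0 : ℂ)).smul_const v).const_add x
    rw [one_smul] at this
    exact hgx.comp_hasDerivAt (0 : ℂ) this
  rw [h2.deriv] at h1
  calc _ ≤ _ := h1
    _ = _ := by field_simp

/-- Weierstrass' theorem: Cauchy estimates make the derivatives uniformly Cauchy near each point, so
the limit may be differentiated. -/
lemma differentiableOn_of_tendstoLocallyUniformlyOn {E : Type*} [NormedAddCommGroup E]
    [NormedSpace ℂ E] {U : Set E} (hU : IsOpen U) {F : ℕ → E → ℂ} {f : E → ℂ}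
    (hF : ∀ n, DifferentiableOn ℂ (F n) U)
    (hlim : ∀ x ∈ U, ∃ r > 0, TendstoUniformlyOn F f Filter.atTop (Metric.ball x r)) :
    DifferentiableOn ℂ f U := by
  intro x hx
  obtain ⟨r₁, hr₁, h₁⟩ := hlim x hx
  obtain ⟨r₂, hr₂, h₂⟩ := Metric.isOpen_iff.1 hU x hx
  obtain ⟨r, hr, hru, hrU⟩ : ∃ r > 0, TendstoUniformlyOn F f Filter.atTop (Metric.ball x (2 * r)) ∧
      Metric.ball x (2 * r) ⊆ U := by
    refine ⟨min r₁ r₂ / 2, by positivity, ?_, ?_⟩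
    · exact h₁.mono (Metric.ball_subset_ball (by linarith [min_le_left r₁ r₂]))
    · exact (Metric.ball_subset_ball (by linarith [min_le_right r₁ r₂])).trans h₂
  have hball : ∀ y ∈ Metric.ball x r, Metric.ball y r ⊆ Metric.ball x (2 * r) := fun y hy =>
    Metric.ball_subset_ball' (by linarith [Metric.mem_ball.1 hy])
  have hdy : ∀ n, ∀ y ∈ Metric.ball x r, DifferentiableAt ℂ (F n) y := fun n y hy =>
    (hF n).differentiableAt (hU.mem_nhds (hrU (hball y hy (Metric.mem_ball_self hr))))
  have hcau : UniformCauchySeqOn (fun n => fderiv ℂ (F n)) Filter.atTop (Metric.ball x r) := by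
    rw [Metric.uniformCauchySeqOn_iff]
    intro ε hε
    -- The Cauchy estimate divides by `r / 2`, leaving `ε / 2 < ε`.
    obtain ⟨N, hN⟩ := Metric.uniformCauchySeqOn_iff.1 hru.uniformCauchySeqOn (ε / 2 * (r / 2))
      (by positivity)
    refine ⟨N, fun m hm n hn y hy => ?_⟩
    rw [dist_eq_norm, ← fderiv_sub (hdy m y hy) (hdy n y hy)]
    have := norm_fderiv_le_of_forall_mem_ball (g := F m - F n) (x := y) (C := ε / 2 * (r / 2)) hr
      (((hF m).sub (hF n)).mono ((hball y hy).trans hrU))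
      (fun z hz => by
        have := hN m hm n hn z (hball y hy hz)
        rw [dist_eq_norm] at this
        exact this.le)
    rw [mul_div_cancel_right₀ _ (by positivity)] at this
    linarith
  have hpt : ∀ y ∈ Metric.ball x r, ∃ l, Filter.Tendsto (fun n => fderiv ℂ (F n) y) Filter.atTop
      (nhds l) := fun y hy => cauchySeq_tendsto_of_complete (hcau.cauchySeq hy)
  choose! f' hf' using hpt
  have hun := hcau.tendstoUniformlyOn_of_tendsto hf'
  have := hasFDerivAt_of_tendstoUniformlyOn Metric.isOpen_ball hun
    (fun n y hy => (hdy n y hy).hasFDerivAt)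
    (fun y hy => hru.tendsto_at (hball y hy (Metric.mem_ball_self hr)))
    (Metric.mem_ball_self hr)
  exact this.differentiableAt.differentiableWithinAt

/-! ### Existence of reproducing kernels -/

section Existence

variable {E : Type*} [NormedAddCommGroup E] [NormedSpace ℂ E] [ProperSpace E] [MeasureSpace E]
  [BorelSpace E] [(volume : Measure E).IsAddHaarMeasure]

/-- Near every point of `U`, Lebesgue measure is bounded by a multiple of `μ`. -/
def LocallyDominatesVolume (U : Set E) (μ : Measure E) : Prop :=
  ∀ p ∈ U, ∃ r > 0, ∃ C : ENNReal, C ≠ ⊤ ∧ Metric.ball p r ⊆ U ∧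
    volume.restrict (Metric.ball p r) ≤ C • μ

lemma eLpNorm_two_sq {X : Type*} [MeasurableSpace X] (μ : Measure X) (f : X → ℂ) :
    eLpNorm f 2 μ ^ 2 = ∫⁻ x, ‖f x‖ₑ ^ 2 ∂μ := by
  rw [eLpNorm_eq_lintegral_rpow_enorm_toReal (by norm_num) (by norm_num), ← ENNReal.rpow_natCast,
    ← ENNReal.rpow_mul]
  norm_num

/-- Point evaluations are bounded in the `L²(μ)` norm, uniformly near `p`: the mean value inequality
on balls of radius `r / 2` about points of `ball p (r / 2)`, where `volume ≤ C • μ`. -/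
lemma LocallyDominatesVolume.enorm_le {U : Set E} {μ : Measure E}
    (h : LocallyDominatesVolume U μ) {p : E} (hp : p ∈ U) :
    ∃ r > 0, ∃ M : NNReal, Metric.ball p r ⊆ U ∧ ∀ f : E → ℂ, DifferentiableOn ℂ f U →
      ∀ x ∈ Metric.ball p r, ‖f x‖ₑ ≤ M * eLpNorm f 2 μ := by
  obtain ⟨r, hr, C, hC, hrU, hCμ⟩ := h p hp
  have hv0 : volume (Metric.ball (0 : E) (r / 2)) ≠ 0 :=
    (Metric.measure_ball_pos _ _ (by positivity)).ne'
  have hvt : volume (Metric.ball (0 : E) (r / 2)) ≠ ⊤ := measure_ball_lt_top.ne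
  set v := volume (Metric.ball (0 : E) (r / 2))
  refine ⟨r / 2, by positivity, ((C / v) ^ (1 / 2 : ℝ)).toNNReal,
    (Metric.ball_subset_ball (by linarith)).trans hrU, fun f hf x hx => ?_⟩
  have hsub : Metric.ball x (r / 2) ⊆ Metric.ball p r :=
    Metric.ball_subset_ball' (by linarith [Metric.mem_ball.1 hx])
  have h1 := norm_sq_mul_volume_ball_le (hf.mono (hsub.trans hrU))
  rw [Measure.addHaar_ball_center] at h1
  have h2 : ∫⁻ y in Metric.ball x (r / 2), ‖f y‖ₑ ^ 2 ≤ C * eLpNorm f 2 μ ^ 2 := by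
    rw [eLpNorm_two_sq, ← smul_eq_mul, ← lintegral_smul_measure]
    exact lintegral_mono' ((Measure.restrict_mono hsub le_rfl).trans hCμ) le_rfl
  have h3 : ‖f x‖ₑ ^ 2 ≤ C / v * eLpNorm f 2 μ ^ 2 := by
    rw [div_eq_mul_inv, mul_right_comm, ← div_eq_mul_inv, ENNReal.le_div_iff_mul_le (.inl hv0)
      (.inl hvt)]
    exact h1.trans h2
  have hCv : (C / v) ^ (1 / 2 : ℝ) ≠ ⊤ :=
    ENNReal.rpow_ne_top_of_nonneg (by norm_num) (ENNReal.div_ne_top hC hv0)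
  rw [ENNReal.coe_toNNReal hCv]
  refine (ENNReal.pow_le_pow_left_iff two_ne_zero).1 (h3.trans_eq ?_)
  rw [mul_pow, ← ENNReal.rpow_natCast ((C / v) ^ (1 / 2 : ℝ)), ← ENNReal.rpow_mul]
  norm_num

/-- The classes of `L²(μ)` that have a representative holomorphic on `U`. -/
noncomputable def holomorphicL2 (U : Set E) (μ : Measure E) : Submodule ℂ (Lp ℂ 2 μ) where
  carrier := {F | ∃ f : E → ℂ, DifferentiableOn ℂ f U ∧ F =ᵐ[μ] f}
  zero_mem' := ⟨0, differentiableOn_const 0, Lp.coeFn_zero _ _ _⟩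
  add_mem' := by
    rintro F G ⟨f, hf, hFf⟩ ⟨g, hg, hGg⟩
    exact ⟨f + g, hf.add hg, (Lp.coeFn_add F G).trans (hFf.add hGg)⟩
  smul_mem' := by
    rintro c F ⟨f, hf, hFf⟩
    exact ⟨c • f, hf.const_smul c, (Lp.coeFn_smul c F).trans (hFf.const_smul c)⟩

/-- By the evaluation bounds, an `L²` Cauchy sequence of holomorphic functions is locally uniformly
Cauchy, so its pointwise limit is holomorphic. A subsequence converging almost everywhere identifies
that limit with the `L²` limit. -/
lemma isClosed_holomorphicL2 {U : Set E} (hU : IsOpen U) {μ : Measure E} (hμU : μ Uᶜ = 0)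
    (h : LocallyDominatesVolume U μ) :
    IsClosed (holomorphicL2 U μ : Set (Lp ℂ 2 μ)) := by
  refine isClosed_of_closure_subset fun F hF => ?_
  obtain ⟨G, hG, hGF⟩ := mem_closure_iff_seq_limit.1 hF
  choose g hg hGg using hG
  have hdist : ∀ m n, eLpNorm (g m - g n) 2 μ = edist (G m) (G n) := by
    intro m n
    rw [Lp.edist_def]
    exact eLpNorm_congr_ae ((hGg m).symm.sub (hGg n).symm)
  have hloc : ∀ p ∈ U, ∃ r > 0, Metric.ball p r ⊆ U ∧
      UniformCauchySeqOn g Filter.atTop (Metric.ball p r) := by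
    intro p hp
    obtain ⟨r, hr, M, hrU, hM⟩ := h.enorm_le hp
    refine ⟨r, hr, hrU, ?_⟩
    rw [Metric.uniformCauchySeqOn_iff]
    intro ε hε
    obtain ⟨N, hN⟩ := Metric.cauchySeq_iff.1 hGF.cauchySeq (ε / (M + 1)) (by positivity)
    refine ⟨N, fun m hm n hn x hx => ?_⟩
    have h1 := hM _ ((hg m).sub (hg n)) x hx
    rw [hdist, Pi.sub_apply, ← edist_eq_enorm_sub, edist_nndist, edist_nndist, ← ENNReal.coe_mul,
      ENNReal.coe_le_coe] at h1
    have h2 : dist (g m x) (g n x) ≤ M * dist (G m) (G n) := by exact_mod_cast h1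
    have h3 := (lt_div_iff₀ (by positivity)).1 (hN m hm n hn)
    have h4 : 0 ≤ dist (G m) (G n) := dist_nonneg
    linarith
  have hpt : ∀ x ∈ U, ∃ l, Filter.Tendsto (fun n => g n x) Filter.atTop (nhds l) := by
    intro x hx
    obtain ⟨r, hr, -, hc⟩ := hloc x hx
    exact cauchySeq_tendsto_of_complete (hc.cauchySeq (Metric.mem_ball_self hr))
  choose! f hf using hpt
  refine ⟨f, differentiableOn_of_tendstoLocallyUniformlyOn hU hg fun x hx => ?_, ?_⟩
  · obtain ⟨r, hr, hrU, hc⟩ := hloc x hx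
    exact ⟨r, hr, hc.tendstoUniformlyOn_of_tendsto fun y hy => hf y (hrU hy)⟩
  · obtain ⟨ns, hns, hae⟩ := (tendstoInMeasure_of_tendsto_Lp hGF).exists_seq_tendsto_ae
    have hU' : ∀ᵐ x ∂μ, x ∈ U := by
      rw [ae_iff]; exact hμU
    filter_upwards [hae, hU', ae_all_iff.2 hGg] with x hx hxU hxG
    refine tendsto_nhds_unique hx ?_
    simp only [hxG]
    exact (hf x hxU).comp hns.tendsto_atTop

/-- `K` is the reproducing kernel of the space of functions that are holomorphic on `U` and
square-integrable with respect to `μ`. -/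
def IsReproducingKernel (U : Set E) (μ : Measure E) (K : E → E → ℂ) : Prop :=
  (∀ z ∈ U, DifferentiableOn ℂ (fun w => starRingEnd ℂ (K z w)) U ∧
    MemLp (fun w => starRingEnd ℂ (K z w)) 2 μ) ∧
  ∀ f : E → ℂ, DifferentiableOn ℂ f U → MemLp f 2 μ → ∀ z ∈ U, f z = ∫ w, f w * K z w ∂μ

/-- Riesz representation of the bounded evaluation functionals on the Hilbert space `holomorphicL2 U
μ`. -/
theorem exists_isReproducingKernel {U : Set E} (hU : IsOpen U) {μ : Measure E} (hμU : μ Uᶜ = 0)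
    (h : LocallyDominatesVolume U μ) :
    ∃ K : E → E → ℂ, IsReproducingKernel U μ K := by
  have hclosed := isClosed_holomorphicL2 hU hμU h
  have : CompleteSpace (holomorphicL2 U μ) := hclosed.completeSpace_coe
  have hex : ∀ F : holomorphicL2 U μ, ∃ f : E → ℂ, DifferentiableOn ℂ f U ∧
      (F : Lp ℂ 2 μ) =ᵐ[μ] f := fun F => F.2
  choose rep hrepd hrep using hex
  -- The difference has norm zero, so the evaluation bound kills it at every point of `U`. Hence the
  -- chosen representatives depend linearly on their classes at points of `U`.
  have huniq : ∀ f g : E → ℂ, DifferentiableOn ℂ f U → DifferentiableOn ℂ g U → f =ᵐ[μ] g →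
      ∀ p ∈ U, f p = g p := by
    intro f g hf hg hfg p hp
    obtain ⟨r, hr, M, -, hM⟩ := h.enorm_le hp
    have := hM _ (hf.sub hg) p (Metric.mem_ball_self hr)
    have h0 : eLpNorm (f - g) 2 μ = 0 := by
      rw [← eLpNorm_zero (μ := μ) (p := 2) (ε := ℂ)]
      refine eLpNorm_congr_ae ?_
      filter_upwards [hfg] with x hx
      simp [hx]
    rw [h0, mul_zero, nonpos_iff_eq_zero, enorm_eq_zero] at this
    exact sub_eq_zero.1 this
  have hkex : ∀ z ∈ U, ∃ k : holomorphicL2 U μ, ∀ F, inner ℂ k F = rep F z := by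
    intro z hz
    obtain ⟨r, hr, M, -, hM⟩ := h.enorm_le hz
    let ev : holomorphicL2 U μ →ₗ[ℂ] ℂ :=
      { toFun := fun F => rep F z
        map_add' := fun F G => huniq (rep (F + G)) (rep F + rep G) (hrepd _)
          ((hrepd _).add (hrepd _))
          ((hrep _).symm.trans ((Lp.coeFn_add _ _).trans ((hrep F).add (hrep G)))) z hz
        map_smul' := fun c F => huniq (rep (c • F)) (c • rep F) (hrepd _)
          ((hrepd _).const_smul c)
          ((hrep _).symm.trans ((Lp.coeFn_smul _ _).trans ((hrep F).const_smul c))) z hz }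
    let evc : holomorphicL2 U μ →L[ℂ] ℂ := ev.mkContinuous M fun F => by
      have h1 := hM _ (hrepd F) z (Metric.mem_ball_self hr)
      rw [← eLpNorm_congr_ae (hrep F), ← Lp.enorm_def] at h1
      have h2 : ‖rep F z‖ₑ ≤ ((M * ‖F‖₊ : NNReal) : ENNReal) := by
        rw [ENNReal.coe_mul]
        exact h1
      rw [enorm_eq_nnnorm, ENNReal.coe_le_coe] at h2
      exact_mod_cast h2
    refine ⟨(InnerProductSpace.toDual ℂ _).symm evc, fun F => ?_⟩
    rw [InnerProductSpace.toDual_symm_apply]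
    rfl
  choose! k hk using hkex
  refine ⟨fun z w => starRingEnd ℂ (rep (k z) w), fun z hz => ?_, fun f hf hf2 z hz => ?_⟩
  · simp only [Complex.conj_conj]
    exact ⟨hrepd _, (memLp_congr_ae (hrep _)).1 (Lp.memLp _)⟩
  · let F : holomorphicL2 U μ := ⟨hf2.toLp f, f, hf, hf2.coeFn_toLp⟩
    have hF : (F : Lp ℂ 2 μ) =ᵐ[μ] f := hf2.coeFn_toLp
    have h1 : rep F z = f z := huniq _ _ (hrepd F) hf ((hrep F).symm.trans hF) z hz
    rw [← h1, ← hk z hz F, Submodule.coe_inner, L2.inner_def]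
    refine integral_congr_ae ?_
    filter_upwards [hF, hrep (k z)] with x hx hx'
    rw [hx, hx']
    simp

end Existence

/-! ### Taylor coefficients at the origin -/

/-- The `k`-th Taylor coefficient of `g` at the origin. -/
noncomputable def taylorCoeff (k : ℕ) (g : ℂ → ℂ) : ℂ := (k.factorial : ℂ)⁻¹ * iteratedDeriv k g 0

lemma circleAverage_inv_pow_mul {g : ℂ → ℂ} {R s : ℝ} (k : ℕ) (hs : 0 < s) (hsR : s < R)
    (hg : DifferentiableOn ℂ g (Metric.ball 0 R)) :
    Real.circleAverage (fun c => (c ^ k)⁻¹ * g c) 0 s = taylorCoeff k g := by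
  have hd : DiffContOnCl ℂ g (Metric.ball 0 s) :=
    hg.diffContOnCl_ball (Metric.closedBall_subset_ball hsR)
  have h := hd.circleIntegral_one_div_sub_center_pow_smul hs k
  rw [Real.circleAverage_eq_circleIntegral hs.ne', taylorCoeff]
  have h2 : ∮ z in C(0, s), (z - 0)⁻¹ • ((z ^ k)⁻¹ * g z) =
      ∮ z in C(0, s), (1 / (z - 0) ^ (k + 1)) • g z := by
    refine circleIntegral.integral_congr hs.le fun z _ => ?_
    simp only [sub_zero, smul_eq_mul, pow_succ]
    rw [one_div, mul_inv]
    ring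
  rw [h2, h]
  simp only [smul_eq_mul]
  have : (2 * Real.pi * Complex.I : ℂ) ≠ 0 := by simp [Real.pi_ne_zero]
  field_simp

lemma hasSum_taylorCoeff {g : ℂ → ℂ} {R : ℝ} (hg : DifferentiableOn ℂ g (Metric.ball 0 R)) {c : ℂ}
    (hc : c ∈ Metric.ball 0 R) : HasSum (fun k => taylorCoeff k g * c ^ k) (g c) := by
  refine (Complex.hasSum_taylorSeries_on_ball hg hc).congr_fun fun k => ?_
  simp [taylorCoeff]
  ring

lemma taylorCoeff_comp_mul_left (k : ℕ) (g : ℂ → ℂ) (a : ℂ) :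
    taylorCoeff k (fun c => g (a * c)) = a ^ k * taylorCoeff k g := by
  have h : ∀ c, iteratedDeriv k (fun c => g (a * c)) c = a ^ k * iteratedDeriv k g (a * c) := by
    induction k with
    | zero => simp
    | succ k ih =>
      intro c
      rw [iteratedDeriv_succ, funext ih, deriv_const_mul_field, deriv_comp_mul_left,
        ← iteratedDeriv_succ, smul_eq_mul, pow_succ]
      ring
  rw [taylorCoeff, taylorCoeff, h, mul_zero]
  ring

/-- Room beyond the unit circle, for the Cauchy formula on it and for evaluating Taylor series at
`1`. -/
lemma exists_one_lt_mul_lt {a r : ℝ} (har : a < r) : ∃ R > 1, a * R < r := by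
  have h : ContinuousAt (fun R : ℝ => a * R) 1 := by fun_prop
  have h1 := h.eventually (gt_mem_nhds (show a * 1 < r by simpa using har))
  obtain ⟨ε, hε, h2⟩ := Metric.eventually_nhds_iff.1 h1
  refine ⟨1 + ε / 2, by linarith, h2 ?_⟩
  rw [dist_self_add_left, Real.norm_eq_abs, abs_of_pos (by positivity)]
  linarith

/-! ### The projection of a holomorphic function on a ball to a power of a linear form -/

section Ball

variable {V : Type*} [NormedAddCommGroup V] [InnerProductSpace ℂ V]

/-- The rotation by `c` of the orthogonal complement of a unit vector `u`. -/
noncomputable def rotateOrthogonal (u : V) (c : ℂ) (W : V) : V :=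
  inner ℂ u W • u + c • (W - inner ℂ u W • u)

lemma norm_rotateOrthogonal_sq {u : V} (hu : ‖u‖ = 1) (c : ℂ) (W : V) :
    ‖rotateOrthogonal u c W‖ ^ 2 =
      ‖inner ℂ u W‖ ^ 2 + ‖c‖ ^ 2 * ‖W - inner ℂ u W • u‖ ^ 2 := by
  have h : inner ℂ (inner ℂ u W • u) (c • (W - inner ℂ u W • u)) = 0 := by
    simp only [inner_smul_left, inner_smul_right, inner_sub_right]
    simp only [inner_self_eq_norm_sq_to_K, hu, map_one, one_pow, mul_one]
    ring
  rw [rotateOrthogonal, pow_two, norm_add_sq_eq_norm_sq_add_norm_sq_of_inner_eq_zero _ _ h]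
  simp only [norm_smul, hu]
  ring

lemma norm_rotateOrthogonal_eq {u : V} (hu : ‖u‖ = 1) {c : ℂ} (hc : ‖c‖ = 1) (W : V) :
    ‖rotateOrthogonal u c W‖ = ‖W‖ := by
  have h1 := norm_rotateOrthogonal_sq hu c W
  have h2 := norm_rotateOrthogonal_sq hu 1 W
  simp only [rotateOrthogonal, one_smul, add_sub_cancel, norm_one] at h2
  rw [hc, ← h2] at h1
  exact (pow_left_inj₀ (norm_nonneg _) (norm_nonneg _) two_ne_zero).1 h1

lemma norm_rotateOrthogonal_le {u : V} (hu : ‖u‖ = 1) {c : ℂ} (hc : ‖c‖ ≤ 1) (W : V) :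
    ‖rotateOrthogonal u c W‖ ≤ ‖W‖ := by
  have h1 := norm_rotateOrthogonal_sq hu c W
  have h2 := norm_rotateOrthogonal_sq hu 1 W
  simp only [rotateOrthogonal, one_smul, add_sub_cancel, norm_one] at h2
  refine (pow_le_pow_iff_left₀ (norm_nonneg _) (norm_nonneg _) two_ne_zero).1 ?_
  rw [h1, h2]
  gcongr

lemma inner_rotateOrthogonal {u : V} (hu : ‖u‖ = 1) (c : ℂ) (W : V) :
    inner ℂ (rotateOrthogonal u c W) u = inner ℂ W u := by
  simp only [rotateOrthogonal, inner_add_left, inner_smul_left, inner_sub_left,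
    inner_self_eq_norm_sq_to_K, hu]
  simp

variable [ProperSpace V] [MeasureSpace V] [BorelSpace V] [(volume : Measure V).IsAddHaarMeasure]

lemma measurePreserving_rotateOrthogonal {u : V} (hu : ‖u‖ = 1) {c : ℂ} (hc : ‖c‖ = 1) :
    MeasurePreserving (rotateOrthogonal u c) (volume : Measure V) volume := by
  have : FiniteDimensional ℂ V := FiniteDimensional.of_locallyCompactSpace ℂ
  let T : V →ₗᵢ[ℂ] V :=
    { toFun := rotateOrthogonal u c
      map_add' := fun x y => by
        simp only [rotateOrthogonal, inner_add_right]; module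
      map_smul' := fun a x => by
        simp only [rotateOrthogonal, inner_smul_right, RingHom.id_apply]; module
      norm_map' := norm_rotateOrthogonal_eq hu hc }
  exact (T.toLinearIsometryEquiv rfl).measurePreserving_addHaar

/-- Two averages. Rotating the complement of `u` fixes `⟨W, u⟩`, and the mean value property
replaces `g W` by its value at the projection of `W` to the line of `u`. Rotating all of `V` by
scalars then isolates the `k`-th Taylor coefficient on that line. Since `inner ℂ` is
conjugate-linear in its first slot, `inner ℂ W u` is the conjugate of the coordinate `inner ℂ u W`.
-/
lemma setIntegral_ball_mul_inner_pow {g : V → ℂ} {r : ℝ}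
    (hg : DifferentiableOn ℂ g (Metric.ball 0 r)) (hi : IntegrableOn g (Metric.ball 0 r)) {u : V}
    (hu : ‖u‖ = 1) (k : ℕ) :
    ∫ W in Metric.ball 0 r, g W * inner ℂ W u ^ k =
      taylorCoeff k (fun c => g (c • u)) *
        ((∫ W in Metric.ball (0 : V) r, ‖inner ℂ u W‖ ^ (2 * k) : ℝ) : ℂ) := by
  have hm : MeasurableSet (Metric.ball (0 : V) r) := Metric.isOpen_ball.measurableSet
  have hi1 : IntegrableOn (fun W => g W * inner ℂ W u ^ k) (Metric.ball 0 r) := by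
    refine Integrable.mul_bdd (c := r ^ k) hi (by fun_prop) ?_
    filter_upwards [ae_restrict_mem hm] with W hW
    rw [norm_pow]
    have := norm_inner_le_norm (𝕜 := ℂ) W u
    rw [hu, mul_one] at this
    have h2 := mem_ball_zero_iff.1 hW
    gcongr
    linarith
  have hP : ∀ W : V, ‖inner ℂ u W‖ ≤ ‖W‖ := fun W => by
    simpa [hu] using norm_inner_le_norm (𝕜 := ℂ) u W
  obtain ⟨hi2, he1⟩ := integrable_circleAverage_and_integral_eq
    (μ := volume.restrict (Metric.ball (0 : V) r)) (ρ := rotateOrthogonal u)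
    (by unfold rotateOrthogonal Function.uncurry; fun_prop)
    (fun c hc => (measurePreserving_rotateOrthogonal hu hc).restrict_of_preimage_eq hm
      (by ext x; simp [norm_rotateOrthogonal_eq hu hc])) hi1
  have hav1 : Set.EqOn (fun W => Real.circleAverage (fun c => g (rotateOrthogonal u c W) *
      inner ℂ (rotateOrthogonal u c W) u ^ k) 0 1)
      (fun W => g (inner ℂ u W • u) * inner ℂ W u ^ k) (Metric.ball 0 r) := by
    intro W hW
    have hd : DifferentiableOn ℂ
        (fun c : ℂ => g (rotateOrthogonal u c W) * inner ℂ (rotateOrthogonal u c W) u ^ k)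
        (Metric.closedBall 0 |1|) := by
      simp only [inner_rotateOrthogonal hu]
      refine DifferentiableOn.mul_const (hg.comp (by unfold rotateOrthogonal; fun_prop)
        fun c hc => ?_) _
      simp only [abs_one, mem_closedBall_zero_iff, mem_ball_zero_iff] at hc hW ⊢
      exact (norm_rotateOrthogonal_le hu hc W).trans_lt hW
    -- The centre `c = 0` corresponds to the orthogonal projection of `W` to the line of `u`.
    have := (hd.diffContOnCl_ball subset_rfl).circleAverage
    refine this.trans ?_
    rw [inner_rotateOrthogonal hu]
    simp [rotateOrthogonal]
  rw [integrable_congr ((ae_restrict_mem hm).mono hav1)] at hi2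
  rw [he1, setIntegral_congr_fun hm hav1]
  obtain ⟨-, he2⟩ := integrable_circleAverage_and_integral_eq
    (μ := volume.restrict (Metric.ball (0 : V) r)) (ρ := fun c W => c • W)
    (by fun_prop)
    (fun c hc => (unitSMul (E := V) c hc).measurePreserving_addHaar.restrict_of_preimage_eq hm
      (by ext x; simp)) hi2
  rw [he2, ← integral_complex_ofReal, ← integral_const_mul]
  refine setIntegral_congr_fun hm fun W hW => ?_
  simp only [mem_ball_zero_iff] at hW
  obtain ⟨R, hR1, hR⟩ := exists_one_lt_mul_lt ((hP W).trans_lt hW)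
  have hG : DifferentiableOn ℂ (fun c : ℂ => g ((inner ℂ u W * c) • u)) (Metric.ball 0 R) := by
    refine hg.comp (by fun_prop) fun c hc => ?_
    simp only [mem_ball_zero_iff, norm_smul, norm_mul, hu, mul_one] at hc ⊢
    exact (mul_le_mul_of_nonneg_left hc.le (norm_nonneg _)).trans_lt hR
  -- On the unit circle the conjugate of `c` is `c⁻¹`, so the conjugate-linear factor yields the
  -- Cauchy kernel `c ^ (-k)`.
  have hav2 : Set.EqOn (fun c : ℂ => g (inner ℂ u (c • W) • u) * inner ℂ (c • W) u ^ k)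
      (fun c => inner ℂ W u ^ k • ((c ^ k)⁻¹ * g ((inner ℂ u W * c) • u)))
      (Metric.sphere 0 |1|) := by
    intro c hc
    simp only [abs_one, mem_sphere_zero_iff_norm] at hc
    have hcc : starRingEnd ℂ c = c⁻¹ := by
      rw [Complex.inv_def, Complex.normSq_eq_norm_sq, hc]; simp
    simp only [inner_smul_right, inner_smul_left, hcc, mul_pow, inv_pow, smul_eq_mul,
      mul_comm c (inner ℂ u W)]
    ring
  have hconj : inner ℂ W u * inner ℂ u W = ((‖inner ℂ u W‖ ^ 2 : ℝ) : ℂ) := by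
    rw [← inner_conj_symm, Complex.conj_mul']
    push_cast; rfl
  rw [Real.circleAverage_congr_sphere hav2, Real.circleAverage_fun_smul,
    circleAverage_inv_pow_mul k one_pos hR1 hG,
    taylorCoeff_comp_mul_left k (fun c => g (c • u)), smul_eq_mul, ← mul_assoc, ← mul_pow, hconj,
    pow_mul]
  push_cast
  ring

end Ball

/-! ### Fibred integration over Hartogs domains -/

section Hartogs

variable {E V : Type*} [NormedAddCommGroup E] [NormedSpace ℂ E]
  [NormedAddCommGroup V] [InnerProductSpace ℂ V]

/-- The domain `{(z, Z) : z ∈ D, ‖Z‖² < φ(z)}` in `E × V`. -/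
def fibredBall (V : Type*) [NormedAddCommGroup V] (D : Set E) (φ : E → ℝ) : Set (E × V) :=
  {p | p.1 ∈ D ∧ ‖p.2‖ ^ 2 < φ p.1}

lemma isOpen_fibredBall {D : Set E} {φ : E → ℝ} (hD : IsOpen D) (hφ : ContinuousOn φ D) :
    IsOpen (fibredBall V D φ) := by
  have h1 : ContinuousOn (fun p : E × V => φ p.1 - ‖p.2‖ ^ 2) (D ×ˢ Set.univ) :=
    (hφ.comp continuousOn_fst fun p hp => hp.1).sub (by fun_prop)
  have := h1.isOpen_inter_preimage (hD.prod isOpen_univ) isOpen_Ioi (t := Set.Ioi 0)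
  convert this using 1
  ext p
  simp [fibredBall]

lemma mem_fibredBall_iff {D : Set E} {φ : E → ℝ} {z : E} (hz : z ∈ D) {W : V} :
    (z, W) ∈ fibredBall V D φ ↔ W ∈ Metric.ball 0 (Real.sqrt (φ z)) := by
  rw [mem_ball_zero_iff, Real.lt_sqrt (norm_nonneg _)]
  simp [fibredBall, hz]

variable [MeasureSpace E] [BorelSpace E] [MeasureSpace V] [BorelSpace V]
  [SecondCountableTopology E] [SecondCountableTopology V]

lemma lintegral_fibredBall [SFinite (volume : Measure E)] [SFinite (volume : Measure V)]
    {D : Set E} {φ : E → ℝ} (hD : IsOpen D) (hφ : ContinuousOn φ D)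
    {h : E × V → ENNReal} (hh : AEMeasurable h (volume.restrict (fibredBall V D φ))) :
    ∫⁻ p in fibredBall V D φ, h p =
      ∫⁻ z in D, ∫⁻ W in Metric.ball 0 (Real.sqrt (φ z)), h (z, W) := by
  have hm : MeasurableSet (fibredBall V D φ) := (isOpen_fibredBall hD hφ).measurableSet
  rw [← lintegral_indicator hm, Measure.volume_eq_prod, lintegral_prod _ ((aemeasurable_indicator_iff hm).2 hh),
    ← lintegral_indicator hD.measurableSet]
  refine lintegral_congr fun z => ?_
  by_cases hz : z ∈ D
  · rw [Set.indicator_of_mem hz, ← lintegral_indicator Metric.isOpen_ball.measurableSet]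
    refine lintegral_congr fun W => ?_
    classical
    simp only [Set.indicator_apply, mem_fibredBall_iff hz]
  · rw [Set.indicator_of_notMem hz]
    simp [fibredBall, hz]

lemma integral_fibredBall [SFinite (volume : Measure E)] [SFinite (volume : Measure V)]
    {D : Set E} {φ : E → ℝ} (hD : IsOpen D) (hφ : ContinuousOn φ D)
    {h : E × V → ℂ} (hh : IntegrableOn h (fibredBall V D φ)) :
    (∀ᵐ z ∂volume.restrict D, IntegrableOn (fun W => h (z, W)) (Metric.ball 0 (Real.sqrt (φ z)))) ∧
    ∫ p in fibredBall V D φ, h p =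
      ∫ z in D, ∫ W in Metric.ball 0 (Real.sqrt (φ z)), h (z, W) := by
  have hm : MeasurableSet (fibredBall V D φ) := (isOpen_fibredBall hD hφ).measurableSet
  have hi := (integrable_indicator_iff hm).2 hh
  rw [Measure.volume_eq_prod] at hi
  classical
  have hfib : ∀ z ∈ D, (fun W : V => (fibredBall V D φ).indicator h (z, W)) =
      (Metric.ball 0 (Real.sqrt (φ z))).indicator fun W => h (z, W) := by
    intro z hz
    ext W
    simp only [Set.indicator_apply, mem_fibredBall_iff hz]
  constructor
  · filter_upwards [ae_restrict_of_ae hi.prod_right_ae, ae_restrict_mem hD.measurableSet]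
      with z hz hzD
    rw [hfib z hzD] at hz
    exact (integrable_indicator_iff Metric.isOpen_ball.measurableSet).1 hz
  · rw [← integral_indicator hm, Measure.volume_eq_prod, integral_prod _ hi,
      ← integral_indicator hD.measurableSet]
    refine integral_congr_ae (Filter.Eventually.of_forall fun z => ?_)
    by_cases hz : z ∈ D
    · simp only [Set.indicator_of_mem hz, hfib z hz]
      rw [integral_indicator Metric.isOpen_ball.measurableSet]
    · simp [fibredBall, hz]

end Hartogs

/-! ### Taylor coefficients along the fibres -/

section Fibre

variable {E V : Type*} [NormedAddCommGroup E] [NormedSpace ℂ E]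
  [NormedAddCommGroup V] [InnerProductSpace ℂ V]

lemma differentiableOn_fibre {D : Set E} {φ : E → ℝ} {f : E × V → ℂ}
    (hf : DifferentiableOn ℂ f (fibredBall V D φ)) {z : E} (hz : z ∈ D) :
    DifferentiableOn ℂ (fun W => f (z, W)) (Metric.ball 0 (Real.sqrt (φ z))) :=
  hf.comp (by fun_prop) fun _ hW => (mem_fibredBall_iff hz).2 hW

lemma differentiableOn_fibre_line {D : Set E} {φ : E → ℝ} {f : E × V → ℂ}
    (hf : DifferentiableOn ℂ f (fibredBall V D φ)) {z : E} (hz : z ∈ D) {u : V} (hu : ‖u‖ = 1) :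
    DifferentiableOn ℂ (fun c : ℂ => f (z, c • u)) (Metric.ball 0 (Real.sqrt (φ z))) :=
  (differentiableOn_fibre hf hz).comp (by fun_prop) fun c hc => by
    simpa [norm_smul, hu] using hc

/-- Near `z₀` the coefficient is a Cauchy integral over one fixed circle, which is differentiated
under the integral sign. -/
lemma differentiableOn_taylorCoeff_fibre [ProperSpace E] [ProperSpace V] [MeasurableSpace E]
    [BorelSpace E] [MeasurableSpace V] [BorelSpace V]
    {D : Set E} {φ : E → ℝ} (hD : IsOpen D) (hφ : ContinuousOn φ D) (hφpos : ∀ z ∈ D, 0 < φ z)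
    {f : E × V → ℂ} (hf : DifferentiableOn ℂ f (fibredBall V D φ)) {u : V} (hu : ‖u‖ = 1) (k : ℕ) :
    DifferentiableOn ℂ (fun z => taylorCoeff k (fun c => f (z, c • u))) D := by
  intro z₀ hz₀
  -- By continuity of `φ`, all fibres near `z₀` contain the ball of radius `R`. The circle has
  -- radius `R / 4` and `f` is bounded for fibre radius up to `R / 2`, which leaves room for Cauchy
  -- estimates.
  set R := Real.sqrt (φ z₀ / 2) with hR
  have hR0 : 0 < R := Real.sqrt_pos.2 (by linarith [hφpos z₀ hz₀])
  have hev : ∀ᶠ z in nhds z₀, z ∈ D ∧ R < Real.sqrt (φ z) := by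
    have h1 := (hφ.continuousAt (hD.mem_nhds hz₀)).eventually
      (lt_mem_nhds (show φ z₀ / 2 < φ z₀ by linarith [hφpos z₀ hz₀]))
    filter_upwards [h1, hD.mem_nhds hz₀] with z hz hzD
    exact ⟨hzD, Real.sqrt_lt_sqrt (by linarith [hφpos z₀ hz₀]) hz⟩
  obtain ⟨δ, hδ, hball⟩ := Metric.nhds_basis_closedBall.eventually_iff.1 hev
  have hKsub : Metric.closedBall z₀ δ ×ˢ Metric.closedBall (0 : V) (R / 2) ⊆
      fibredBall V D φ := by
    rintro ⟨z, W⟩ ⟨hz, hW⟩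
    obtain ⟨hzD, hzR⟩ := hball hz
    rw [mem_fibredBall_iff hzD, mem_ball_zero_iff]
    have := mem_closedBall_zero_iff.1 hW
    simp only at this
    linarith
  obtain ⟨C, hC⟩ := ((isCompact_closedBall z₀ δ).prod
    (isCompact_closedBall (0 : V) (R / 2))).exists_bound_of_continuousOn
      (hf.continuousOn.mono hKsub)
  set r := min (δ / 2) (R / 4) with hr
  have hr0 : 0 < r := by positivity
  have hbsub : ∀ z ∈ Metric.ball z₀ (δ / 2), ∀ W : V, ‖W‖ ≤ R / 4 →
      Metric.ball (z, W) r ⊆ Metric.closedBall z₀ δ ×ˢ Metric.closedBall (0 : V) (R / 2) := by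
    rintro z hz W hW ⟨z', W'⟩ h
    rw [← ball_prod_same] at h
    have h1 := Metric.mem_ball.1 h.1
    have h2 := mem_ball_iff_norm.1 h.2
    simp only at h1 h2
    constructor
    · simp only [Metric.mem_closedBall]
      have := dist_triangle z' z z₀
      linarith [Metric.mem_ball.1 hz, min_le_left (δ / 2) (R / 4)]
    · simp only [mem_closedBall_zero_iff]
      have := norm_sub_norm_le W' W
      linarith [min_le_right (δ / 2) (R / 4)]
  set γ : ℝ → ℂ := circleMap 0 (R / 4) with hγ
  have hγn : ∀ θ, ‖γ θ • u‖ ≤ R / 4 := fun θ => by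
    rw [norm_smul, hu, mul_one, hγ, norm_circleMap_zero, abs_of_pos (by positivity)]
  have hγc : Continuous γ := continuous_circleMap _ _
  have hda : ∀ z ∈ Metric.ball z₀ (δ / 2), ∀ θ, DifferentiableAt ℂ f (z, γ θ • u) := by
    intro z hz θ
    exact hf.differentiableAt ((isOpen_fibredBall hD hφ).mem_nhds
      (hKsub (hbsub z hz _ (hγn θ) (Metric.mem_ball_self hr0))))
  have key : HasFDerivAt (fun z => ∫ θ in 0..2 * Real.pi, (γ θ ^ k)⁻¹ * f (z, γ θ • u))
      (∫ θ in 0..2 * Real.pi,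
        (γ θ ^ k)⁻¹ • (fderiv ℂ f (z₀, γ θ • u)).comp (ContinuousLinearMap.inl ℂ E V)) z₀ := by
    have hcont : ∀ z ∈ Metric.ball z₀ (δ / 2),
        Continuous fun θ => (γ θ ^ k)⁻¹ * f (z, γ θ • u) := by
      intro z hz
      refine Continuous.mul (Continuous.inv₀ (by fun_prop) fun θ => ?_) ?_
      · simp [hγ, hR0.ne']
      · exact continuous_iff_continuousAt.2 fun θ =>
          (hda z hz θ).continuousAt.comp_of_eq (f := fun θ => (z, γ θ • u)) (by fun_prop) rfl
    refine (intervalIntegral.hasFDerivAt_integral_of_dominated_of_fderiv_le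
      (F' := fun z θ => (γ θ ^ k)⁻¹ • (fderiv ℂ f (z, γ θ • u)).comp
        (ContinuousLinearMap.inl ℂ E V))
      (bound := fun _ => ((R / 4) ^ k)⁻¹ * (C / (r / 2)))
      (Metric.ball_mem_nhds z₀ (half_pos hδ)) ?_ ?_ ?_ ?_ ?_ ?_)
    · filter_upwards [Metric.ball_mem_nhds z₀ (half_pos hδ)] with z hz
      exact (hcont z hz).aestronglyMeasurable
    · exact (hcont z₀ (Metric.mem_ball_self (half_pos hδ))).intervalIntegrable _ _
    · have : FiniteDimensional ℂ E := FiniteDimensional.of_locallyCompactSpace ℂ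
      have : FiniteDimensional ℂ V := FiniteDimensional.of_locallyCompactSpace ℂ
      have : ProperSpace (E × V →L[ℂ] ℂ) :=
        FiniteDimensional.proper ℂ (E × V →L[ℂ] ℂ)
      have h1 : Measurable fun θ => fderiv ℂ f (z₀, γ θ • u) :=
        (measurable_fderiv ℂ f).comp (Continuous.measurable (by fun_prop))
      have h2 : AEStronglyMeasurable (fun θ => fderiv ℂ f (z₀, γ θ • u))
          (volume.restrict (Set.uIoc 0 (2 * Real.pi))) := h1.aestronglyMeasurable
      have h3 : Continuous fun L : E × V →L[ℂ] ℂ => L.comp (ContinuousLinearMap.inl ℂ E V) := by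
        fun_prop
      have h4 : AEStronglyMeasurable (fun θ => (γ θ ^ k)⁻¹)
          (volume.restrict (Set.uIoc 0 (2 * Real.pi))) :=
        (hγc.measurable.pow_const k).inv.aestronglyMeasurable
      exact h4.smul (h3.comp_aestronglyMeasurable h2)
    · refine Filter.Eventually.of_forall fun θ _ z hz => ?_
      rw [norm_smul, norm_inv, norm_pow, hγ, norm_circleMap_zero, abs_of_pos (by positivity), ← hγ]
      have hb := hbsub z hz _ (hγn θ)
      have h1 := norm_fderiv_le_of_forall_mem_ball hr0 (hf.mono (hb.trans hKsub))
        fun y hy => hC y (hb hy)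
      gcongr
      calc _ ≤ ‖fderiv ℂ f (z, γ θ • u)‖ * ‖ContinuousLinearMap.inl ℂ E V‖ :=
            ContinuousLinearMap.opNorm_comp_le _ _
        _ ≤ ‖fderiv ℂ f (z, γ θ • u)‖ * 1 := by
            gcongr; exact ContinuousLinearMap.norm_inl_le_one ℂ E V
        _ ≤ _ := by rwa [mul_one]
    · exact intervalIntegrable_const
    · refine Filter.Eventually.of_forall fun θ _ z hz => ?_
      refine HasFDerivAt.const_mul ?_ _
      exact (hda z hz θ).hasFDerivAt.comp z (hasFDerivAt_prodMk_left z (γ θ • u))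
  have heq : (fun z => taylorCoeff k (fun c => f (z, c • u))) =ᶠ[nhds z₀]
      fun z => (2 * Real.pi)⁻¹ • ∫ θ in 0..2 * Real.pi, (γ θ ^ k)⁻¹ * f (z, γ θ • u) := by
    filter_upwards [hev] with z hz
    rw [← circleAverage_inv_pow_mul k (show 0 < R / 4 by positivity)
      (show R / 4 < Real.sqrt (φ z) by linarith [hz.2]) (differentiableOn_fibre_line hf hz.1 hu)]
    rfl
  refine DifferentiableAt.differentiableWithinAt (heq.differentiableAt_iff.2 ?_)
  exact key.differentiableAt.const_smul ((2 * Real.pi)⁻¹ : ℝ)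

end Fibre

/-! ### Weighted Bergman spaces on the base, and existence of Bergman kernels -/

section Weighted

variable {E : Type*} [NormedAddCommGroup E] [NormedSpace ℂ E] [ProperSpace E] [MeasureSpace E]
  [BorelSpace E] [(volume : Measure E).IsAddHaarMeasure]

/-- Lebesgue measure on `D` with density `φ ^ j`. -/
noncomputable def weightedMeasure (D : Set E) (φ : E → ℝ) (j : ℕ) : Measure E :=
  (volume.restrict D).withDensity fun z => ENNReal.ofReal (φ z ^ j)

lemma aemeasurable_weight {D : Set E} {φ : E → ℝ} (hD : IsOpen D) (hφ : ContinuousOn φ D) (j : ℕ) :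
    AEMeasurable (fun z => ENNReal.ofReal (φ z ^ j)) (volume.restrict D) :=
  ((hφ.pow j).aemeasurable hD.measurableSet).ennreal_ofReal

lemma lintegral_weightedMeasure {D : Set E} {φ : E → ℝ} (hD : IsOpen D) (hφ : ContinuousOn φ D)
    (j : ℕ) (h : E → ENNReal) :
    ∫⁻ z, h z ∂weightedMeasure D φ j = ∫⁻ z in D, ENNReal.ofReal (φ z ^ j) * h z := by
  rw [weightedMeasure, lintegral_withDensity_eq_lintegral_mul_non_measurable₀ _
    (aemeasurable_weight hD hφ j) (by simp)]
  rfl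

lemma integral_weightedMeasure {D : Set E} {φ : E → ℝ} (hD : IsOpen D) (hφ : ContinuousOn φ D)
    (hφpos : ∀ z ∈ D, 0 < φ z) (j : ℕ) (h : E → ℂ) :
    ∫ z, h z ∂weightedMeasure D φ j = ∫ z in D, ((φ z ^ j : ℝ) : ℂ) * h z := by
  rw [weightedMeasure, integral_withDensity_eq_integral_toReal_smul₀
    (aemeasurable_weight hD hφ j) (by simp)]
  refine setIntegral_congr_fun hD.measurableSet fun z hz => ?_
  simp only [ENNReal.toReal_ofReal (pow_nonneg (hφpos z hz).le j), Complex.real_smul]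

lemma weightedMeasure_compl {D : Set E} {φ : E → ℝ} (hD : IsOpen D) (j : ℕ) :
    weightedMeasure D φ j Dᶜ = 0 := by
  have h : weightedMeasure D φ j ≪ volume.restrict D := withDensity_absolutelyContinuous _ _
  exact h (by simp [Measure.restrict_apply hD.measurableSet.compl])

/-- Near `p` the density is at least `(φ p / 2) ^ j`, by continuity and positivity of `φ`. -/
lemma locallyDominatesVolume_weightedMeasure {D : Set E} {φ : E → ℝ} (hD : IsOpen D)
    (hφ : ContinuousOn φ D) (hφpos : ∀ z ∈ D, 0 < φ z) (j : ℕ) :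
    LocallyDominatesVolume D (weightedMeasure D φ j) := by
  intro p hp
  have hc : ContinuousAt φ p := hφ.continuousAt (hD.mem_nhds hp)
  have h1 := hc.eventually (lt_mem_nhds (show φ p / 2 < φ p by linarith [hφpos p hp]))
  obtain ⟨r, hr, h2⟩ := Metric.eventually_nhds_iff_ball.1 (h1.and (hD.mem_nhds hp))
  have hpos : 0 < (φ p / 2) ^ j := pow_pos (by linarith [hφpos p hp]) _
  have hne : ENNReal.ofReal ((φ p / 2) ^ j) ≠ 0 := by simpa using hpos
  refine ⟨r, hr, (ENNReal.ofReal ((φ p / 2) ^ j))⁻¹, by simpa using hne, fun z hz => (h2 z hz).2, ?_⟩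
  refine Measure.le_iff.2 fun s hs => ?_
  rw [Measure.smul_apply, smul_eq_mul, ← ENNReal.div_eq_inv_mul,
    ENNReal.le_div_iff_mul_le (.inl hne) (.inl ENNReal.ofReal_ne_top), weightedMeasure,
    withDensity_apply _ hs, mul_comm, Measure.restrict_restrict hs, Measure.restrict_apply hs,
    ← setLIntegral_const]
  calc ∫⁻ _ in s ∩ Metric.ball p r, ENNReal.ofReal ((φ p / 2) ^ j)
      ≤ ∫⁻ z in s ∩ Metric.ball p r, ENNReal.ofReal (φ z ^ j) := by
        refine setLIntegral_mono' (hs.inter Metric.isOpen_ball.measurableSet) fun z hz => ?_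
        have h3 := (h2 z hz.2).1
        have h4 := hφpos p hp
        gcongr
    _ ≤ ∫⁻ z in s ∩ D, ENNReal.ofReal (φ z ^ j) :=
        lintegral_mono_set fun z hz => ⟨hz.1, (h2 z hz.2).2⟩

lemma locallyDominatesVolume_restrict {U : Set E} (hU : IsOpen U) :
    LocallyDominatesVolume U (volume.restrict U) := by
  intro p hp
  obtain ⟨r, hr, h⟩ := Metric.isOpen_iff.1 hU p hp
  exact ⟨r, hr, 1, by simp, h, by rw [one_smul]; exact Measure.restrict_mono h le_rfl⟩

theorem isBergmanKernel_bergmanKernel {U : Set E} (hU : IsOpen U) :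
    IsBergmanKernel U (bergmanKernel U) := by
  have h : ∃ K : E → E → ℂ, IsBergmanKernel U K := by
    obtain ⟨K, h1, h2⟩ := exists_isReproducingKernel hU (μ := volume.restrict U)
      (by simp [Measure.restrict_apply hU.measurableSet.compl])
      (locallyDominatesVolume_restrict hU)
    exact ⟨K, h1, fun f hf => h2 f hf.1 hf.2⟩
  rw [bergmanKernel, dif_pos h]
  exact h.choose_spec

end Weighted

/-- Each of `conj (K q ·)` and `conj (K p ·)` is reproduced at the other point; the two integrals
are conjugate. -/
lemma IsBergmanKernel.conj_symm {E : Type*} [NormedAddCommGroup E] [NormedSpace ℂ E]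
    [MeasureSpace E] {U : Set E} {K : E → E → ℂ} (hK : IsBergmanKernel U K) {p q : E}
    (hp : p ∈ U) (hq : q ∈ U) : starRingEnd ℂ (K q p) = K p q := by
  have h1 := hK.2 _ (hK.1 q hq) p hp
  have h2 := hK.2 _ (hK.1 p hp) q hq
  rw [h1, ← Complex.conj_conj (K p q), h2, ← integral_conj]
  simp [mul_comm]

/-! ### Moments of balls -/

/-- The integral of `|⟨u, W⟩| ^ (2 * k)` over the ball of radius `r` in `V` is
`γ k * r ^ (2 * (k + d))`, for every unit vector `u`. -/
def HasBallMoments (V : Type*) [NormedAddCommGroup V] [InnerProductSpace ℂ V] [MeasureSpace V]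
    (d : ℕ) (γ : ℕ → ℝ) : Prop :=
  ∀ k, 0 < γ k ∧ ∀ u : V, ‖u‖ = 1 → ∀ r > 0,
    ∫ W in Metric.ball (0 : V) r, ‖inner ℂ u W‖ ^ (2 * k) = γ k * r ^ (2 * (k + d))

section Moments

variable {V : Type*} [NormedAddCommGroup V] [InnerProductSpace ℂ V] [ProperSpace V]
  [MeasureSpace V] [BorelSpace V] [(volume : Measure V).IsAddHaarMeasure] {d : ℕ} {γ : ℕ → ℝ}

lemma integrableOn_norm_inner_pow (u : V) (r : ℝ) (j : ℕ) :
    IntegrableOn (fun W : V => ‖inner ℂ u W‖ ^ j) (Metric.ball 0 r) :=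
  (ContinuousOn.integrableOn_compact (isCompact_closedBall (0 : V) r) (by fun_prop)).mono_set
    Metric.ball_subset_closedBall

lemma HasBallMoments.lintegral (hγ : HasBallMoments V d γ) (k : ℕ) {u : V} (hu : ‖u‖ = 1) {r : ℝ}
    (hr : 0 < r) :
    ∫⁻ W in Metric.ball (0 : V) r, ‖inner ℂ u W ^ k‖ₑ ^ 2 =
      ENNReal.ofReal (γ k * r ^ (2 * (k + d))) := by
  rw [← (hγ k).2 u hu r hr, ofReal_integral_eq_lintegral_ofReal
    (integrableOn_norm_inner_pow u r (2 * k)) (Filter.Eventually.of_forall fun W => by positivity)]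
  refine lintegral_congr fun W => ?_
  rw [← ofReal_norm, ← ENNReal.ofReal_pow (norm_nonneg _), norm_pow, ← pow_mul, mul_comm k]

/-- Cauchy–Schwarz applied to the projection identity, with one factor of the moment cancelled.
Integrated over `D`, it puts the Taylor coefficients in the weighted space. -/
lemma HasBallMoments.enorm_taylorCoeff_sq_le (hγ : HasBallMoments V d γ) (k : ℕ) {u : V}
    (hu : ‖u‖ = 1) {r : ℝ} (hr : 0 < r) {g : V → ℂ}
    (hg : DifferentiableOn ℂ g (Metric.ball 0 r)) :
    ENNReal.ofReal (γ k * r ^ (2 * (k + d))) * ‖taylorCoeff k (fun c => g (c • u))‖ₑ ^ 2 ≤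
      ∫⁻ W in Metric.ball 0 r, ‖g W‖ₑ ^ 2 := by
  have hm : MeasurableSet (Metric.ball (0 : V) r) := Metric.isOpen_ball.measurableSet
  have hmeas : AEStronglyMeasurable g (volume.restrict (Metric.ball 0 r)) :=
    hg.continuousOn.aestronglyMeasurable hm
  by_cases htop : ∫⁻ x in Metric.ball 0 r, ‖g x‖ₑ ^ 2 = ⊤
  · rw [htop]; exact le_top
  have hfin : IsFiniteMeasure (volume.restrict (Metric.ball (0 : V) r)) :=
    ⟨by simpa using measure_ball_lt_top⟩
  have hL2 : MemLp g 2 (volume.restrict (Metric.ball 0 r)) := by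
    refine ⟨hmeas, ?_⟩
    rw [eLpNorm_lt_top_iff_lintegral_rpow_enorm_lt_top (by norm_num) (by norm_num)]
    simpa using Ne.lt_top htop
  have h1 := setIntegral_ball_mul_inner_pow hg (hL2.integrable (by norm_num)) hu k
  have h2 := enorm_integral_mul_sq_le hmeas (g := fun W => inner ℂ W u ^ k)
    (Continuous.aestronglyMeasurable (by fun_prop))
  have h3 : ∀ W : V, ‖inner ℂ W u ^ k‖ₑ = ‖inner ℂ u W ^ k‖ₑ := fun W => by
    rw [← ofReal_norm, ← ofReal_norm, norm_pow, norm_pow, norm_inner_symm]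
  simp only [h3] at h2
  have hpos : 0 < γ k * r ^ (2 * (k + d)) := mul_pos (hγ k).1 (by positivity)
  rw [h1, hγ.lintegral k hu hr, (hγ k).2 u hu r hr, enorm_mul, mul_pow,
    ← ofReal_norm ((_ : ℝ) : ℂ), Complex.norm_real, Real.norm_of_nonneg hpos.le, pow_two
    (ENNReal.ofReal _), ← mul_assoc] at h2
  rw [mul_comm]
  exact (ENNReal.mul_le_mul_iff_left (by simpa using hpos) ENNReal.ofReal_ne_top).1 h2

end Moments

/-! ### The Bergman kernel of a fibred ball -/

section Expansion

lemma memLp_two_iff {X : Type*} [MeasurableSpace X] {μ : Measure X} {f : X → ℂ} :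
    MemLp f 2 μ ↔ AEStronglyMeasurable f μ ∧ ∫⁻ x, ‖f x‖ₑ ^ 2 ∂μ < ⊤ := by
  rw [MemLp, ← eLpNorm_two_sq]
  simp [lt_top_iff_ne_top]

lemma sqrt_pow_two_mul {x : ℝ} (hx : 0 ≤ x) (j : ℕ) : Real.sqrt x ^ (2 * j) = x ^ j := by
  rw [pow_mul, Real.sq_sqrt hx]

variable {E V : Type*} [NormedAddCommGroup E] [NormedSpace ℂ E] [ProperSpace E] [MeasureSpace E]
  [BorelSpace E] [(volume : Measure E).IsAddHaarMeasure]
  [NormedAddCommGroup V] [InnerProductSpace ℂ V] [ProperSpace V]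
  [MeasureSpace V] [BorelSpace V] [(volume : Measure V).IsAddHaarMeasure]
  {d : ℕ} {γ : ℕ → ℝ} {D : Set E} {φ : E → ℝ}

lemma memLp_taylorCoeff_fibre (hγ : HasBallMoments V d γ) (hD : IsOpen D)
    (hφ : ContinuousOn φ D) (hφpos : ∀ z ∈ D, 0 < φ z) {f : E × V → ℂ}
    (hf : DifferentiableOn ℂ f (fibredBall V D φ))
    (hf2 : MemLp f 2 (volume.restrict (fibredBall V D φ))) {u : V} (hu : ‖u‖ = 1) (k : ℕ) :
    MemLp (fun z => taylorCoeff k (fun c => f (z, c • u))) 2 (weightedMeasure D φ (k + d)) := by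
  rw [memLp_two_iff]
  constructor
  · exact ((differentiableOn_taylorCoeff_fibre hD hφ hφpos hf hu k).continuousOn.aestronglyMeasurable
      hD.measurableSet).mono_ac (withDensity_absolutelyContinuous _ _)
  have h1 := (memLp_two_iff.1 hf2).2
  rw [lintegral_fibredBall hD hφ (hf2.1.enorm.pow_const 2)] at h1
  rw [lintegral_weightedMeasure hD hφ]
  have h2 : ENNReal.ofReal (γ k) * ∫⁻ z in D, ENNReal.ofReal (φ z ^ (k + d)) *
      ‖taylorCoeff k (fun c => f (z, c • u))‖ₑ ^ 2 < ⊤ := by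
    rw [← lintegral_const_mul' _ _ ENNReal.ofReal_ne_top]
    refine lt_of_le_of_lt (setLIntegral_mono' hD.measurableSet fun z hz => ?_) h1
    have := hγ.enorm_taylorCoeff_sq_le k hu (Real.sqrt_pos.2 (hφpos z hz))
      (differentiableOn_fibre hf hz)
    rwa [sqrt_pow_two_mul (hφpos z hz).le, ENNReal.ofReal_mul (hγ k).1.le, mul_assoc] at this
  exact (ENNReal.mul_lt_top_iff.1 h2).elim (fun h => h.2) (fun h => h.elim
    (fun h => absurd h (by simpa using (hγ k).1)) fun h => by rw [h]; exact ENNReal.zero_lt_top)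

/-- The homogeneous component `B(z, w) ⟨Z, W⟩ ^ k` of a kernel. -/
noncomputable def kernelComponent (B : E → E → ℂ) (k : ℕ) (p q : E × V) : ℂ :=
  B p.1 q.1 * inner ℂ q.2 p.2 ^ k

lemma exists_unit_smul [Nontrivial V] (Z : V) : ∃ u : V, ‖u‖ = 1 ∧ Z = (‖Z‖ : ℂ) • u := by
  rcases eq_or_ne Z 0 with rfl | hZ
  · obtain ⟨u, hu⟩ := exists_norm_eq V zero_le_one
    exact ⟨u, hu, by simp⟩
  · refine ⟨(‖Z‖ : ℂ)⁻¹ • Z, by simp [norm_smul, hZ], ?_⟩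
    rw [smul_smul, mul_inv_cancel₀ (by simpa using hZ), one_smul]

/-- By Fubini, the squared norm is `γ k * ‖Z‖ ^ (2 * k)` times the weighted squared norm of `conj (B
z ·)`, with `p = (z, Z)`. -/
lemma isBergmanFunction_conj_kernelComponent [Nontrivial V] (hγ : HasBallMoments V d γ)
    (hD : IsOpen D) (hφ : ContinuousOn φ D) (hφpos : ∀ z ∈ D, 0 < φ z) (k : ℕ)
    {B : E → E → ℂ} (hB : IsReproducingKernel D (weightedMeasure D φ (k + d)) B)
    {p : E × V} (hp : p.1 ∈ D) :
    IsBergmanFunction (fibredBall V D φ) fun q => starRingEnd ℂ (kernelComponent B k p q) := by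
  obtain ⟨u, hu, hZ⟩ := exists_unit_smul p.2
  have hform : (fun q => starRingEnd ℂ (kernelComponent B k p q)) =
      fun q : E × V => starRingEnd ℂ (B p.1 q.1) * inner ℂ p.2 q.2 ^ k := by
    ext q; simp [kernelComponent]
  rw [hform]
  have hd : DifferentiableOn ℂ (fun q : E × V => starRingEnd ℂ (B p.1 q.1) * inner ℂ p.2 q.2 ^ k)
      (fibredBall V D φ) := by
    refine DifferentiableOn.mul ?_ ?_
    · exact (hB.1 p.1 hp).1.comp (f := fun q : E × V => q.1) differentiableOn_fst fun q hq => hq.1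
    · exact (((innerSL ℂ p.2).differentiable.comp differentiable_snd).pow k).differentiableOn
  refine ⟨hd, ?_⟩
  have hmeas := hd.continuousOn.aestronglyMeasurable (isOpen_fibredBall hD hφ).measurableSet
    (μ := volume)
  rw [memLp_two_iff]
  refine ⟨hmeas, ?_⟩
  rw [lintegral_fibredBall hD hφ (hmeas.enorm.pow_const 2)]
  have h1 := (memLp_two_iff.1 (hB.1 p.1 hp).2).2
  rw [lintegral_weightedMeasure hD hφ] at h1
  have h2 : ∀ z ∈ D, ∫⁻ W in Metric.ball (0 : V) (Real.sqrt (φ z)),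
      ‖starRingEnd ℂ (B p.1 z) * inner ℂ p.2 W ^ k‖ₑ ^ 2 =
      ‖(‖p.2‖ : ℂ) ^ k‖ₑ ^ 2 * ENNReal.ofReal (γ k) *
        (ENNReal.ofReal (φ z ^ (k + d)) * ‖starRingEnd ℂ (B p.1 z)‖ₑ ^ 2) := by
    intro z hz
    have h3 := hγ.lintegral k hu (Real.sqrt_pos.2 (hφpos z hz))
    rw [sqrt_pow_two_mul (hφpos z hz).le, ENNReal.ofReal_mul (hγ k).1.le] at h3
    have h4 : ∀ W : V, inner ℂ p.2 W = ‖p.2‖ * inner ℂ u W := fun W => by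
      conv_lhs => rw [hZ, inner_smul_left]
      simp
    simp only [h4, mul_pow, enorm_mul]
    rw [lintegral_const_mul' _ _ (by simp [enorm_ne_top]), lintegral_const_mul' _ _ (by simp), h3]
    ring
  rw [setLIntegral_congr_fun hD.measurableSet h2, lintegral_const_mul' _ _ (by finiteness)]
  exact ENNReal.mul_lt_top (by finiteness) h1

/-- The fibre integral projects `f` to its `k`-th coefficient and produces the weight `φ ^ (k + d)`;
the base integral is then the reproducing property of `B`. -/
lemma integral_mul_kernelComponent [Nontrivial V] (hγ : HasBallMoments V d γ)
    (hD : IsOpen D) (hφ : ContinuousOn φ D) (hφpos : ∀ z ∈ D, 0 < φ z) (k : ℕ)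
    {B : E → E → ℂ} (hB : IsReproducingKernel D (weightedMeasure D φ (k + d)) B)
    {f : E × V → ℂ} (hf : IsBergmanFunction (fibredBall V D φ) f) {p : E × V} (hp : p.1 ∈ D) :
    ∫ q in fibredBall V D φ, f q * kernelComponent B k p q =
      γ k * taylorCoeff k (fun c => f (p.1, c • p.2)) := by
  obtain ⟨u, hu, hZ⟩ := exists_unit_smul p.2
  have hC := isBergmanFunction_conj_kernelComponent hγ hD hφ hφpos k hB hp
  have hC2 : MemLp (kernelComponent B k p) 2 (volume.restrict (fibredBall V D φ)) := by
    have := hC.2.star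
    rwa [show star (fun q => starRingEnd ℂ (kernelComponent B k p q)) = kernelComponent B k p from
      funext fun q => Complex.conj_conj _] at this
  have hint : IntegrableOn (fun q => f q * kernelComponent B k p q) (fibredBall V D φ) :=
    hf.2.integrable_mul hC2
  rw [(integral_fibredBall hD hφ hint).2]
  -- Fubini for `‖f‖²` makes `f` square-integrable on almost every fibre, hence integrable, as the
  -- fibre has finite measure.
  have hfint : ∀ᵐ z ∂volume.restrict D,
      IntegrableOn (fun W => f (z, W)) (Metric.ball 0 (Real.sqrt (φ z))) := by
    have hsq : IntegrableOn (fun q => ((‖f q‖ ^ 2 : ℝ) : ℂ)) (fibredBall V D φ) :=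
      ((memLp_two_iff_integrable_sq_norm hf.2.1).1 hf.2).ofReal
    filter_upwards [(integral_fibredBall hD hφ hsq).1, ae_restrict_mem hD.measurableSet] with z hz hzD
    have hfin : IsFiniteMeasure (volume.restrict (Metric.ball (0 : V) (Real.sqrt (φ z)))) :=
      ⟨by simpa using measure_ball_lt_top⟩
    have hmeas := (differentiableOn_fibre hf.1 hzD).continuousOn.aestronglyMeasurable
      (μ := volume) Metric.isOpen_ball.measurableSet
    refine MemLp.integrable (q := 2) (by norm_num)
      ((memLp_two_iff_integrable_sq_norm hmeas).2 ?_)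
    exact hz.re
  have h1 : ∀ᵐ z ∂volume.restrict D, ∫ W in Metric.ball 0 (Real.sqrt (φ z)),
      f (z, W) * kernelComponent B k p (z, W) = γ k * ‖p.2‖ ^ k *
        (((φ z ^ (k + d) : ℝ) : ℂ) * (taylorCoeff k (fun c => f (z, c • u)) * B p.1 z)) := by
    filter_upwards [hfint, ae_restrict_mem hD.measurableSet] with z hz hzD
    have h2 := setIntegral_ball_mul_inner_pow (differentiableOn_fibre hf.1 hzD) hz hu k
    rw [(hγ k).2 u hu _ (Real.sqrt_pos.2 (hφpos z hzD)), sqrt_pow_two_mul (hφpos z hzD).le] at h2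
    have h4 : ∀ W : V, inner ℂ W p.2 = ‖p.2‖ * inner ℂ W u := fun W => by
      conv_lhs => rw [hZ, inner_smul_right]
    have h5 : ∀ W : V, f (z, W) * kernelComponent B k p (z, W) =
        (B p.1 z * ‖p.2‖ ^ k) * (f (z, W) * inner ℂ W u ^ k) := fun W => by
      simp only [kernelComponent, h4, mul_pow]; ring
    simp only [h5]
    rw [integral_const_mul, h2]
    push_cast
    ring
  rw [integral_congr_ae h1, integral_const_mul, ← integral_weightedMeasure hD hφ hφpos,
    ← hB.2 _ (differentiableOn_taylorCoeff_fibre hD hφ hφpos hf.1 hu k)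
      (memLp_taylorCoeff_fibre hγ hD hφ hφpos hf.1 hf.2 hu k) p.1 hp, mul_assoc,
    ← taylorCoeff_comp_mul_left k (fun c => f (p.1, c • u))]
  congr 3
  ext c
  conv_rhs => rw [hZ]
  rw [smul_smul, mul_comm]

/-- Pairing `f = conj (K q ·)` with the `k`-th component gives `γ k` times its Taylor coefficient
along `p.2`, while the reproducing property of `K` at `q` gives the component itself. The Taylor
series of `c ↦ f (p.1, c • p.2)` at `c = 1` is then the expansion. -/
theorem hasSum_bergmanKernel_fibredBall [Nontrivial V] (hγ : HasBallMoments V d γ)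
    (hD : IsOpen D) (hφ : ContinuousOn φ D) (hφpos : ∀ z ∈ D, 0 < φ z)
    {B : ℕ → E → E → ℂ} (hB : ∀ j, IsReproducingKernel D (weightedMeasure D φ j) (B j))
    {K : E × V → E × V → ℂ} (hK : IsBergmanKernel (fibredBall V D φ) K)
    {p q : E × V} (hp : p ∈ fibredBall V D φ) (hq : q ∈ fibredBall V D φ) :
    HasSum (fun k => (γ k : ℂ)⁻¹ * kernelComponent (B (k + d)) k p q) (K p q) := by
  set f : E × V → ℂ := fun x => starRingEnd ℂ (K q x) with hfdef
  have hf : IsBergmanFunction (fibredBall V D φ) f := hK.1 q hq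
  have hcoeff : ∀ k, taylorCoeff k (fun c => f (p.1, c • p.2)) =
      (γ k : ℂ)⁻¹ * kernelComponent (B (k + d)) k p q := by
    intro k
    have h1 := integral_mul_kernelComponent hγ hD hφ hφpos k (hB (k + d)) hf hp.1
    have h2 := hK.2 _ (isBergmanFunction_conj_kernelComponent hγ hD hφ hφpos k (hB (k + d)) hp.1)
      q hq
    have h3 := congrArg (starRingEnd ℂ) h2
    rw [← integral_conj] at h3
    simp only [map_mul, Complex.conj_conj] at h3
    have hγ0 : (γ k : ℂ) ≠ 0 := by exact_mod_cast (hγ k).1.ne'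
    rw [h3, eq_inv_mul_iff_mul_eq₀ hγ0, ← h1]
    simp only [hfdef, mul_comm]
  obtain ⟨R, hR1, hR⟩ := exists_one_lt_mul_lt (Real.lt_sqrt_of_sq_lt hp.2)
  have hd : DifferentiableOn ℂ (fun c : ℂ => f (p.1, c • p.2)) (Metric.ball 0 R) := by
    refine (differentiableOn_fibre hf.1 hp.1).comp (by fun_prop) fun c hc => ?_
    rw [mem_ball_zero_iff] at hc ⊢
    rw [norm_smul, mul_comm]
    exact (mul_le_mul_of_nonneg_left hc.le (norm_nonneg _)).trans_lt hR
  have hs := hasSum_taylorCoeff hd (c := 1) (by simpa using hR1)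
  simp only [one_pow, mul_one, one_smul, hcoeff, Prod.mk.eta] at hs
  simp only [hfdef] at hs
  rwa [hK.conj_symm hp hq] at hs

end Expansion

/-! ### Moments of balls from Gaussian moments -/

section GaussianMoments

variable {V : Type*} [NormedAddCommGroup V] [InnerProductSpace ℂ V] [ProperSpace V]
  [MeasureSpace V] [BorelSpace V] [(volume : Measure V).IsAddHaarMeasure]

lemma setIntegral_ball_norm_inner_pow (u : V) (k : ℕ) {r : ℝ} (hr : 0 < r) :
    ∫ W in Metric.ball (0 : V) r, ‖inner ℂ u W‖ ^ (2 * k) =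
      r ^ (2 * (k + Module.finrank ℂ V)) *
        ∫ W in Metric.ball (0 : V) 1, ‖inner ℂ u W‖ ^ (2 * k) := by
  have : FiniteDimensional ℂ V := FiniteDimensional.of_locallyCompactSpace ℂ
  have : FiniteDimensional ℝ V := FiniteDimensional.complexToReal V
  have h := Measure.setIntegral_comp_smul_of_pos (volume : Measure V)
    (fun W => ‖inner ℂ u W‖ ^ (2 * k)) (Metric.ball 0 1) hr
  rw [smul_unitBall_of_pos hr, finrank_real_of_complex, smul_eq_mul] at h
  have h2 : ∀ W : V, ‖inner ℂ u (r • W)‖ ^ (2 * k) = r ^ (2 * k) * ‖inner ℂ u W‖ ^ (2 * k) := by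
    intro W
    rw [← Complex.coe_smul, inner_smul_right, norm_mul, mul_pow, Complex.norm_real,
      Real.norm_of_nonneg hr.le]
  simp only [h2] at h
  rw [integral_const_mul, eq_inv_mul_iff_mul_eq₀ (by positivity)] at h
  rw [← h]
  ring

lemma lintegral_Ioi_exp_neg (a : ℝ) :
    ∫⁻ s in Set.Ioi a, ENNReal.ofReal (Real.exp (-s)) = ENNReal.ofReal (Real.exp (-a)) := by
  rw [← integral_exp_neg_Ioi a, ofReal_integral_eq_lintegral_ofReal]
  · exact integrableOn_exp_neg_Ioi a
  · exact Filter.Eventually.of_forall fun s => (Real.exp_pos _).le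

/-- Write `exp (-‖W‖²)` as the integral of `exp (-s)` over `s > ‖W‖²` and exchange: the ball of
radius `√s` contributes `s ^ (k + d)` times the unit-ball moment, and the Gamma integral gives `(k +
d)!`. Gaussian moments, unlike ball moments, factor over coordinates. -/
lemma integral_norm_inner_pow_mul_exp (u : V) (k : ℕ) :
    ∫ W : V, ‖inner ℂ u W‖ ^ (2 * k) * Real.exp (-‖W‖ ^ 2) =
      (k + Module.finrank ℂ V).factorial *
        ∫ W in Metric.ball (0 : V) 1, ‖inner ℂ u W‖ ^ (2 * k) := by
  set I := ∫ W in Metric.ball (0 : V) 1, ‖inner ℂ u W‖ ^ (2 * k) with hI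
  set d := Module.finrank ℂ V
  have hI0 : 0 ≤ I := integral_nonneg fun W => by positivity
  have hball : ∀ s > 0, ∫⁻ W in Metric.ball (0 : V) (Real.sqrt s),
      ENNReal.ofReal (‖inner ℂ u W‖ ^ (2 * k)) = ENNReal.ofReal (s ^ (k + d) * I) := by
    intro s hs
    rw [← ofReal_integral_eq_lintegral_ofReal (integrableOn_norm_inner_pow u _ (2 * k))
      (Filter.Eventually.of_forall fun W => by positivity),
      setIntegral_ball_norm_inner_pow u k (Real.sqrt_pos.2 hs), sqrt_pow_two_mul hs.le]
  have hmeas : Measurable fun x : V × ℝ => ENNReal.ofReal (‖inner ℂ u x.1‖ ^ (2 * k)) *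
      (Set.Ioi (‖x.1‖ ^ 2)).indicator (fun s => ENNReal.ofReal (Real.exp (-s))) x.2 := by
    have hc : Continuous fun x : V × ℝ => ‖inner ℂ u x.1‖ ^ (2 * k) := by fun_prop
    refine hc.measurable.ennreal_ofReal.mul ?_
    have : (fun x : V × ℝ =>
        (Set.Ioi (‖x.1‖ ^ 2)).indicator (fun s => ENNReal.ofReal (Real.exp (-s))) x.2) =
        {x : V × ℝ | ‖x.1‖ ^ 2 < x.2}.indicator fun x => ENNReal.ofReal (Real.exp (-x.2)) := by
      ext x; rfl
    rw [this]
    exact Measurable.indicator (by fun_prop)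
      (isOpen_lt (by fun_prop) (by fun_prop)).measurableSet
  have hmain : ∫⁻ W : V, ENNReal.ofReal (‖inner ℂ u W‖ ^ (2 * k) * Real.exp (-‖W‖ ^ 2)) =
      ENNReal.ofReal ((k + d).factorial * I) := by
    calc _ = ∫⁻ W : V, ∫⁻ s : ℝ, ENNReal.ofReal (‖inner ℂ u W‖ ^ (2 * k)) *
          (Set.Ioi (‖W‖ ^ 2)).indicator (fun s => ENNReal.ofReal (Real.exp (-s))) s := by
          refine lintegral_congr fun W => ?_
          rw [lintegral_const_mul' _ _ ENNReal.ofReal_ne_top, lintegral_indicator measurableSet_Ioi,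
            lintegral_Ioi_exp_neg, ENNReal.ofReal_mul (by positivity)]
      _ = ∫⁻ s : ℝ, ∫⁻ W : V, ENNReal.ofReal (‖inner ℂ u W‖ ^ (2 * k)) *
          (Set.Ioi (‖W‖ ^ 2)).indicator (fun s => ENNReal.ofReal (Real.exp (-s))) s :=
          lintegral_lintegral_swap hmeas.aemeasurable
      _ = ∫⁻ s in Set.Ioi (0 : ℝ), ENNReal.ofReal (Real.exp (-s) * (s ^ (k + d) * I)) := by
          rw [← lintegral_indicator measurableSet_Ioi]
          refine lintegral_congr fun s => ?_
          by_cases hs : 0 < s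
          · rw [Set.indicator_of_mem (Set.mem_Ioi.2 hs), ENNReal.ofReal_mul (Real.exp_pos _).le,
              ← hball s hs, ← lintegral_const_mul' _ _ ENNReal.ofReal_ne_top,
              ← lintegral_indicator Metric.isOpen_ball.measurableSet]
            refine lintegral_congr fun W => ?_
            classical
            simp only [Set.indicator_apply, Set.mem_Ioi, mem_ball_zero_iff,
              Real.lt_sqrt (norm_nonneg _)]
            split_ifs <;> simp [mul_comm]
          · rw [Set.indicator_of_notMem (by simpa using hs)]
            refine (lintegral_congr fun W => ?_).trans lintegral_zero
            rw [Set.indicator_of_notMem, mul_zero]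
            simp only [Set.mem_Ioi, not_lt] at hs ⊢
            exact hs.trans (by positivity)
      _ = ENNReal.ofReal (∫ s in Set.Ioi (0 : ℝ), Real.exp (-s) * (s ^ (k + d) * I)) := by
          rw [ofReal_integral_eq_lintegral_ofReal]
          · have := (Real.GammaIntegral_convergent (s := (k + d : ℕ) + 1) (by positivity)).mul_const I
            refine this.congr ?_
            filter_upwards with s
            simp only [add_sub_cancel_right, Real.rpow_natCast, mul_assoc]
          · filter_upwards [ae_restrict_mem measurableSet_Ioi] with s hs
            have : 0 < s := hs
            positivity
      _ = _ := by
          congr 1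
          have h := Real.Gamma_eq_integral (s := (k + d : ℕ) + 1) (by positivity)
          rw [Real.Gamma_nat_eq_factorial] at h
          rw [h, ← integral_mul_const]
          congr 1
          ext s
          simp only [add_sub_cancel_right, Real.rpow_natCast, mul_assoc]
  rw [integral_eq_lintegral_of_nonneg_ae (Filter.Eventually.of_forall fun W => by positivity)
    (Continuous.aestronglyMeasurable (by fun_prop)), hmain, ENNReal.toReal_ofReal (by positivity)]

lemma hasBallMoments_of_gaussian {d : ℕ} (hd : Module.finrank ℂ V = d) {G : ℕ → ℝ}
    (hG0 : ∀ k, 0 < G k)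
    (hG : ∀ k, ∀ u : V, ‖u‖ = 1 →
      ∫ W : V, ‖inner ℂ u W‖ ^ (2 * k) * Real.exp (-‖W‖ ^ 2) = G k) :
    HasBallMoments V d fun k => G k / (k + d).factorial := by
  intro k
  refine ⟨div_pos (hG0 k) (by positivity), fun u hu r hr => ?_⟩
  change _ = G k / _ * _
  rw [setIntegral_ball_norm_inner_pow u k hr, ← hG k u hu, integral_norm_inner_pow_mul_exp, hd]
  field_simp

end GaussianMoments

/-! ### Explicit moments for `ℂ` and `ℂᵐ` -/

lemma integral_complex_norm_pow_mul_exp (k : ℕ) :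
    ∫ x : ℂ, ‖x‖ ^ (2 * k) * Real.exp (-‖x‖ ^ 2) = Real.pi * k.factorial := by
  have h := Complex.integral_rpow_mul_exp_neg_rpow (p := 2) (q := (2 * k : ℕ)) (by norm_num)
    (by have : (0 : ℝ) ≤ (2 * k : ℕ) := by positivity
        linarith)
  have h2 : (((2 * k : ℕ) : ℝ) + 2) / 2 = k + 1 := by push_cast; ring
  rw [h2, Real.Gamma_nat_eq_factorial] at h
  simp only [Real.rpow_natCast, Real.rpow_ofNat] at h
  rw [h]
  ring

lemma hasBallMoments_complex :
    HasBallMoments ℂ 1 fun k => Real.pi * k.factorial / (k + 1).factorial := by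
  refine hasBallMoments_of_gaussian (by simp) (fun k => by positivity) fun k u hu => ?_
  rw [← integral_complex_norm_pow_mul_exp]
  simp [hu]

/-- Both measures are Haar, so they differ by a factor; the Gaussian integral is `π ^ m` for each.
-/
lemma measurePreserving_ofLp_complex (m : ℕ) :
    MeasurePreserving (WithLp.ofLp : EuclideanSpace ℂ (Fin m) → Fin m → ℂ) volume volume := by
  have hc : Continuous (WithLp.ofLp : EuclideanSpace ℂ (Fin m) → Fin m → ℂ) := by fun_prop
  refine ⟨hc.measurable, ?_⟩
  have : (Measure.map (WithLp.ofLp : EuclideanSpace ℂ (Fin m) → Fin m → ℂ)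
      volume).IsAddHaarMeasure :=
    (PiLp.continuousLinearEquiv 2 ℂ (fun _ : Fin m => ℂ)).isAddHaarMeasure_map _
  have h := Measure.isAddLeftInvariant_eq_smul
    (Measure.map (WithLp.ofLp : EuclideanSpace ℂ (Fin m) → Fin m → ℂ) volume) volume
  have h1 : ∫ x : Fin m → ℂ, ∏ i, Real.exp (-‖x i‖ ^ 2)
      ∂(Measure.map (WithLp.ofLp : EuclideanSpace ℂ (Fin m) → Fin m → ℂ) volume) =
      Real.pi ^ m := by
    rw [integral_map hc.measurable.aemeasurable
      (Continuous.aestronglyMeasurable (by fun_prop))]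
    have := GaussianFourier.integral_rexp_neg_mul_sq_norm (V := EuclideanSpace ℂ (Fin m)) one_pos
    rw [finrank_real_of_complex] at this
    simp only [← Real.exp_sum, Finset.sum_neg_distrib]
    simpa [EuclideanSpace.norm_sq_eq] using this
  have h2 : ∫ x : Fin m → ℂ, ∏ i, Real.exp (-‖x i‖ ^ 2) = Real.pi ^ m := by
    rw [integral_fintype_prod_volume_eq_prod (fun _ : Fin m => fun x : ℂ => Real.exp (-‖x‖ ^ 2))]
    have := integral_complex_norm_pow_mul_exp 0
    simp only [mul_zero, pow_zero, one_mul, Nat.factorial_zero, Nat.cast_one, mul_one] at this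
    simp [this]
  rw [h, integral_smul_nnreal_measure, h2] at h1
  have hpi : Real.pi ^ m ≠ 0 := by positivity
  have h3 : ((Measure.addHaarScalarFactor (Measure.map (WithLp.ofLp :
      EuclideanSpace ℂ (Fin m) → Fin m → ℂ) volume) volume : NNReal) : ℝ) = 1 := by
    rw [NNReal.smul_def, smul_eq_mul] at h1
    exact (mul_eq_right₀ hpi).1 h1
  rw [h, show Measure.addHaarScalarFactor _ _ = (1 : NNReal) from by exact_mod_cast h3, one_smul]

lemma exists_linearIsometryEquiv_map_single {m : ℕ} (i : Fin m) {u : EuclideanSpace ℂ (Fin m)}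
    (hu : ‖u‖ = 1) : ∃ T : EuclideanSpace ℂ (Fin m) ≃ₗᵢ[ℂ] EuclideanSpace ℂ (Fin m),
      T u = EuclideanSpace.single i 1 := by
  have hon : Orthonormal ℂ (({i} : Set (Fin m)).domRestrict fun _ => u) := by
    rw [orthonormal_iff_ite]
    rintro ⟨a, rfl⟩ ⟨b, rfl⟩
    simp [Set.domRestrict, inner_self_eq_norm_sq_to_K, hu]
  obtain ⟨b, hb⟩ := hon.exists_orthonormalBasis_extension_of_card_eq (v := fun _ => u) (by simp)
  refine ⟨b.repr, ?_⟩
  rw [← hb i rfl, b.repr_self]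

/-- After an isometry takes `u` to a coordinate vector, the Gaussian moment is a product of one
factor `π k!` and `m - 1` factors `π`. -/
lemma hasBallMoments_euclideanSpace {m : ℕ} (hm : 1 ≤ m) :
    HasBallMoments (EuclideanSpace ℂ (Fin m)) m
      fun k => Real.pi ^ m * k.factorial / (k + m).factorial := by
  refine hasBallMoments_of_gaussian (by simp) (fun k => by positivity) fun k u hu => ?_
  obtain ⟨T, hT⟩ := exists_linearIsometryEquiv_map_single (⟨0, hm⟩ : Fin m) hu
  set i₀ : Fin m := ⟨0, hm⟩
  have h1 := T.measurePreserving_addHaar.integral_comp T.toHomeomorph.measurableEmbedding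
    fun W => ‖inner ℂ (T u) W‖ ^ (2 * k) * Real.exp (-‖W‖ ^ 2)
  simp only [LinearIsometryEquiv.inner_map_map, LinearIsometryEquiv.norm_map] at h1
  rw [h1, hT]
  have h2 := (measurePreserving_ofLp_complex m).integral_comp
    (PiLp.homeomorph 2 (fun _ : Fin m => ℂ)).measurableEmbedding
    fun x => ∏ i, ‖x i‖ ^ (if i = i₀ then 2 * k else 0) * Real.exp (-‖x i‖ ^ 2)
  have h3 : ∀ W : EuclideanSpace ℂ (Fin m),
      ∏ i, ‖W i‖ ^ (if i = i₀ then 2 * k else 0) * Real.exp (-‖W i‖ ^ 2) =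
      ‖inner ℂ (EuclideanSpace.single i₀ (1 : ℂ)) W‖ ^ (2 * k) * Real.exp (-‖W‖ ^ 2) := by
    intro W
    rw [Finset.prod_mul_distrib, ← Real.exp_sum, Finset.sum_neg_distrib,
      ← EuclideanSpace.norm_sq_eq]
    congr 1
    simp [pow_ite, EuclideanSpace.inner_single_left]
  refine (integral_congr_ae (Filter.Eventually.of_forall fun W => (h3 W).symm)).trans (h2.trans ?_)
  rw [integral_fintype_prod_volume_eq_prod
    fun i : Fin m => fun x : ℂ => ‖x‖ ^ (if i = i₀ then 2 * k else 0) * Real.exp (-‖x‖ ^ 2)]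
  have h4 : ∀ i : Fin m, ∫ x : ℂ, ‖x‖ ^ (if i = i₀ then 2 * k else 0) * Real.exp (-‖x‖ ^ 2) =
      Real.pi * if i = i₀ then (k.factorial : ℝ) else 1 := by
    intro i
    split_ifs with hi
    · exact integral_complex_norm_pow_mul_exp k
    · simpa using integral_complex_norm_pow_mul_exp 0
  simp only [h4, Finset.prod_mul_distrib]
  simp

/-! ### Differentiating power series -/

lemma hasFPowerSeriesOnBall_of_hasSum {a : ℕ → ℂ} {f : ℂ → ℂ} {ρ : ℝ} (hρ : 0 < ρ)
    (h : ∀ t ∈ Metric.ball (0 : ℂ) ρ, HasSum (fun k => a k * t ^ k) (f t)) :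
    HasFPowerSeriesOnBall f (FormalMultilinearSeries.ofScalars ℂ a) 0 (ENNReal.ofReal ρ) := by
  refine ⟨?_, by simpa using hρ, fun {y} hy => ?_⟩
  · refine le_of_forall_lt_imp_le_of_dense fun r hr => ?_
    lift r to NNReal using hr.ne_top
    apply FormalMultilinearSeries.le_radius_of_summable
    have hr' : (r : ℝ) < ρ := by
      rw [ENNReal.lt_ofReal_iff_toReal_lt ENNReal.coe_ne_top] at hr
      simpa using hr
    have := (h (r : ℝ) (by simpa using hr')).summable.norm
    simpa using this
  · rw [Metric.eball_ofReal] at hy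
    simpa [FormalMultilinearSeries.ofScalars_apply_eq, mul_comm] using h y hy

/-- The `j`-th derivative is holomorphic on the same disc, so it equals its own Taylor series there,
with coefficients read off from the derivatives of `f` at `0`. -/
lemma hasSum_iteratedDeriv {a : ℕ → ℂ} {f : ℂ → ℂ} {ρ : ℝ} (hρ : 0 < ρ)
    (h : ∀ t ∈ Metric.ball (0 : ℂ) ρ, HasSum (fun k => a k * t ^ k) (f t)) (j : ℕ) {t : ℂ}
    (ht : t ∈ Metric.ball (0 : ℂ) ρ) :
    HasSum (fun k => ((k + j).factorial / k.factorial : ℂ) * a (k + j) * t ^ k)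
      (iteratedDeriv j f t) := by
  have hp := hasFPowerSeriesOnBall_of_hasSum hρ h
  have hd : DifferentiableOn ℂ f (Metric.ball 0 ρ) := by
    simpa [Metric.eball_ofReal] using hp.differentiableOn
  have han := hd.analyticOnNhd Metric.isOpen_ball
  have hcoeff : ∀ k, iteratedDeriv k f 0 = k.factorial * a k := by
    intro k
    have h1 := (han 0 (Metric.mem_ball_self hρ)).hasFPowerSeriesAt.eq_formalMultilinearSeries
      hp.hasFPowerSeriesAt
    have h2 := congrArg (fun p => FormalMultilinearSeries.coeff p k) h1
    simp only [FormalMultilinearSeries.coeff_ofScalars] at h2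
    rw [← h2, mul_div_cancel₀ _ (by exact_mod_cast k.factorial_ne_zero)]
  have hdj : DifferentiableOn ℂ (iteratedDeriv j f) (Metric.ball 0 ρ) := by
    rw [iteratedDeriv_eq_iterate]
    exact (han.iterated_deriv j).differentiableOn
  refine (hasSum_taylorCoeff hdj ht).congr_fun fun k => ?_
  have h3 : iteratedDeriv k (iteratedDeriv j f) 0 = iteratedDeriv (k + j) f 0 := by
    simp only [iteratedDeriv_eq_iterate, Function.iterate_add_apply]
  rw [taylorCoeff, h3, hcoeff]
  ring

/-! ### The inflation formula -/

/-- Thus the kernel determines `L z w` on the whole disc, so the formula holds for every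
representing `L`. -/
lemma exists_mul_conj_eq {a b : ℝ} (ha : 0 < a) (hb : 0 < b) {t : ℂ}
    (ht : t ∈ Metric.ball (0 : ℂ) (Real.sqrt (a * b))) :
    ∃ ζ η : ℂ, ‖ζ‖ ^ 2 < a ∧ ‖η‖ ^ 2 < b ∧ ζ * starRingEnd ℂ η = t := by
  have hab : 0 < Real.sqrt (a * b) := Real.sqrt_pos.2 (mul_pos ha hb)
  rw [mem_ball_zero_iff] at ht
  rcases eq_or_ne t 0 with rfl | ht0
  · exact ⟨0, 0, by simpa, by simpa, by simp⟩
  have hn : (‖t‖ : ℂ) ≠ 0 := by simpa using ht0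
  -- With this `s < 1`, the moduli `√(a s)` and `√(b s)` are admissible and have product `‖t‖`; the
  -- first factor carries the phase.
  set s := ‖t‖ / Real.sqrt (a * b) with hs
  have hs0 : 0 ≤ s := by positivity
  have hs1 : s < 1 := (div_lt_one hab).2 ht
  have hprod : Real.sqrt (a * s) * Real.sqrt (b * s) = ‖t‖ := by
    rw [← Real.sqrt_mul (by positivity), show a * s * (b * s) = a * b * (s * s) by ring,
      Real.sqrt_mul (by positivity), Real.sqrt_mul_self hs0, hs]
    field_simp
  refine ⟨Real.sqrt (a * s) * (t / ‖t‖), Real.sqrt (b * s), ?_, ?_, ?_⟩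
  · rw [norm_mul, norm_div, Complex.norm_real, Complex.norm_real, norm_norm,
      div_self (by simpa using ht0), mul_one, Real.norm_of_nonneg (Real.sqrt_nonneg _),
      Real.sq_sqrt (by positivity)]
    nlinarith
  · rw [Complex.norm_real, Real.norm_of_nonneg (Real.sqrt_nonneg _), Real.sq_sqrt (by positivity)]
    nlinarith
  · rw [Complex.conj_ofReal, mul_right_comm, ← Complex.ofReal_mul, hprod]
    field_simp

lemma isAddHaarMeasure_volume_prod {E V : Type*} [NormedAddCommGroup E] [MeasureSpace E]
    [BorelSpace E] [SecondCountableTopology E] [(volume : Measure E).IsAddHaarMeasure]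
    [SFinite (volume : Measure E)] [NormedAddCommGroup V] [MeasureSpace V] [BorelSpace V]
    [SecondCountableTopology V] [(volume : Measure V).IsAddHaarMeasure]
    [SFinite (volume : Measure V)] : (volume : Measure (E × V)).IsAddHaarMeasure :=
  Measure.prod.instIsAddHaarMeasure _ _

theorem mainTheorem2 (n m : ℕ) (hm : 1 ≤ m)
    (D : Set (EuclideanSpace ℂ (Fin n))) (hDopen : IsOpen D) (hDconn : IsConnected D)
    (hDbdd : Bornology.IsBounded D)
    (φ : EuclideanSpace ℂ (Fin n) → ℝ) (hφcont : ContinuousOn φ D)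
    (hφpos : ∀ z ∈ D, 0 < φ z) (hφbdd : ∃ C : ℝ, ∀ z ∈ D, φ z ≤ C) :
    -- the Bergman kernels of the two domains exist
    IsBergmanKernel (hartogsDomain D φ) (bergmanKernel (hartogsDomain D φ)) ∧
    IsBergmanKernel (inflatedDomain m D φ) (bergmanKernel (inflatedDomain m D φ)) ∧
    -- the kernel of the Hartogs domain is a function `L(z, w, ζ * conj η)`, holomorphic in the
    -- last variable on the disc through which `ζ * conj η` ranges
    (∃ L : EuclideanSpace ℂ (Fin n) → EuclideanSpace ℂ (Fin n) → ℂ → ℂ,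
      RepresentsHartogsKernel D φ L ∧
      ∀ z ∈ D, ∀ w ∈ D,
        DifferentiableOn ℂ (L z w) (Metric.ball 0 (Real.sqrt (φ z * φ w)))) ∧
    -- the inflation formula
    ∀ L : EuclideanSpace ℂ (Fin n) → EuclideanSpace ℂ (Fin n) → ℂ → ℂ,
      RepresentsHartogsKernel D φ L →
      ∀ p ∈ inflatedDomain m D φ, ∀ q ∈ inflatedDomain m D φ,
        bergmanKernel (inflatedDomain m D φ) p q =
          1 / (Real.pi : ℂ) ^ (m - 1) *
            iteratedDeriv (m - 1) (L p.1 q.1) (∑ i, p.2 i * starRingEnd ℂ (q.2 i)) := by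
  have := isAddHaarMeasure_volume_prod (E := EuclideanSpace ℂ (Fin n)) (V := ℂ)
  have := isAddHaarMeasure_volume_prod (E := EuclideanSpace ℂ (Fin n))
    (V := EuclideanSpace ℂ (Fin m))
  have hK₁ : IsBergmanKernel (hartogsDomain D φ) (bergmanKernel (hartogsDomain D φ)) :=
    isBergmanKernel_bergmanKernel (isOpen_fibredBall hDopen hφcont)
  have hK₂ : IsBergmanKernel (inflatedDomain m D φ) (bergmanKernel (inflatedDomain m D φ)) :=
    isBergmanKernel_bergmanKernel (isOpen_fibredBall hDopen hφcont)
  -- One family `B` serves both domains; only the index shift differs, `k + 1` against `k + m`.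
  have hBex : ∀ j, ∃ B, IsReproducingKernel D (weightedMeasure D φ j) B := fun j =>
    exists_isReproducingKernel hDopen (weightedMeasure_compl hDopen j)
      (locallyDominatesVolume_weightedMeasure hDopen hφcont hφpos j)
  choose B hB using hBex
  have hsum₁ : ∀ p ∈ hartogsDomain D φ, ∀ q ∈ hartogsDomain D φ, HasSum
      (fun k => ((Real.pi * k.factorial / (k + 1).factorial : ℝ) : ℂ)⁻¹ * B (k + 1) p.1 q.1 *
        (p.2 * starRingEnd ℂ q.2) ^ k) (bergmanKernel (hartogsDomain D φ) p q) := by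
    intro p hp q hq
    refine (hasSum_bergmanKernel_fibredBall hasBallMoments_complex hDopen hφcont hφpos hB hK₁
      hp hq).congr_fun fun k => ?_
    simp only [kernelComponent, RCLike.inner_apply, mul_assoc]
  have hser : ∀ L, RepresentsHartogsKernel D φ L → ∀ z ∈ D, ∀ w ∈ D,
      ∀ t ∈ Metric.ball (0 : ℂ) (Real.sqrt (φ z * φ w)), HasSum
      (fun k => ((Real.pi * k.factorial / (k + 1).factorial : ℝ) : ℂ)⁻¹ * B (k + 1) z w * t ^ k)
      (L z w t) := by
    intro L hL z hz w hw t ht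
    obtain ⟨ζ, η, hζ, hη, rfl⟩ := exists_mul_conj_eq (hφpos z hz) (hφpos w hw) ht
    have h1 : (z, ζ) ∈ hartogsDomain D φ := ⟨hz, hζ⟩
    have h2 : (w, η) ∈ hartogsDomain D φ := ⟨hw, hη⟩
    have := hsum₁ _ h1 _ h2
    rwa [hL _ h1 _ h2] at this
  have hρ : ∀ z ∈ D, ∀ w ∈ D, 0 < Real.sqrt (φ z * φ w) := fun z hz w hw =>
    Real.sqrt_pos.2 (mul_pos (hφpos z hz) (hφpos w hw))
  refine ⟨hK₁, hK₂, ?_, ?_⟩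
  · have hL : RepresentsHartogsKernel D φ fun z w t => ∑' k : ℕ,
        ((Real.pi * k.factorial / (k + 1).factorial : ℝ) : ℂ)⁻¹ * B (k + 1) z w * t ^ k :=
      fun p hp q hq => (hsum₁ p hp q hq).tsum_eq.symm
    refine ⟨_, hL, fun z hz w hw => ?_⟩
    have := (hasFPowerSeriesOnBall_of_hasSum (hρ z hz w hw)
      (hser _ hL z hz w hw)).differentiableOn
    simpa only [Metric.eball_ofReal] using this
  · intro L hL p hp q hq
    -- From here on `m` is the order of differentiation and the fibre has dimension `m + 1`.
    obtain ⟨m, rfl⟩ : ∃ j, m = j + 1 := ⟨m - 1, by omega⟩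
    have hinner : ∑ i, p.2 i * starRingEnd ℂ (q.2 i) = inner ℂ q.2 p.2 := by
      simp [PiLp.inner_apply]
    have hball : inner ℂ q.2 p.2 ∈ Metric.ball (0 : ℂ) (Real.sqrt (φ p.1 * φ q.1)) := by
      rw [mem_ball_zero_iff, mul_comm, Real.sqrt_mul (hφpos _ hq.1).le]
      exact (norm_inner_le_norm _ _).trans_lt (mul_lt_mul'' (Real.lt_sqrt_of_sq_lt hq.2)
        (Real.lt_sqrt_of_sq_lt hp.2) (norm_nonneg _) (norm_nonneg _))
    have h1 := hasSum_bergmanKernel_fibredBall (hasBallMoments_euclideanSpace hm) hDopen hφcont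
      hφpos hB hK₂ hp hq
    have h2 := (hasSum_iteratedDeriv (hρ p.1 hp.1 q.1 hq.1) (hser L hL p.1 hp.1 q.1 hq.1) m
      hball).mul_left (1 / (Real.pi : ℂ) ^ m)
    rw [hinner, Nat.add_sub_cancel]
    refine h1.unique (h2.congr_fun fun k => ?_)
    -- Both coefficients of `B (k + m + 1)` equal `(k + m + 1)! / (π ^ (m + 1) k!)`: the `(k + m)!`
    -- from differentiation cancels the one in the moment for `ℂ`.
    have hpi : (Real.pi : ℂ) ≠ 0 := by exact_mod_cast Real.pi_ne_zero
    have hf : ∀ j : ℕ, (j.factorial : ℂ) ≠ 0 := fun j => by exact_mod_cast j.factorial_ne_zero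
    have := hf k
    have := hf (k + m)
    have := hf (k + m + 1)
    simp only [kernelComponent, ← add_assoc]
    push_cast
    field_simp
    ring
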